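/- Let $\theta=(L_x,L_y,L_{xy},\mu_x,\mu_y)$ with $L_x>\mu_x>0$, $L_y>\mu_y>0$, $L_{xy}>0$, and put $$S_\theta=\frac{L_x}{\mu_x}+\frac{L_{xy}^2}{\mu_x\mu_y}+\frac{L_y}{\mu_y}.$$ **Problem class.** $\mathcal F(\theta)$ is the class of continuously differentiable $F:\mathbb R^n\times\mathbb R^n\to\mathbb R$ such that $F(\cdot,y)$ is $\mu_x$-strongly convex for every $y$, $F(x,\cdot)$ is $\mu_y$-strongly concave for every $x$, $\nabla_xF$ is $L_x$-Lipschitz in $x$ and $L_{xy}$-Lipschitz in $y$, and $\nabla_yF$ is $L_y$-Lipschitz in $y$ and $L_{xy}$-Lipschitz in $x$. The duality gap is $\Delta_F(x,y)=\sup_{y'}F(x,y')-\inf_{x'}F(x',y)$. **Algorithm class.** A deterministic pure first-order algorithm $\mathcal A$ on $\mathbb R^n\times\mathbb R^n$ is a sequence of arbitrary maps $\mathcal A_x^k,\mathcal A_y^k$ $(k\ge1)$. Applied to $F\in\mathcal F(\theta)$ from $(x^0,y^0)$ it generates iterates $(x^k,y^k)$ and outputs $(\tilde x^k,\tilde y^k)$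 by $$(x^k,\tilde x^k)=\mathcal A_x^k\big(\theta;x^0,\nabla_xF(x^0,y^0),\dots,x^{k-1},\nabla_xF(x^{k-1},y^{k-1})\big),$$ $$(y^k,\tilde y^k)=\mathcal A_y^k\big(\theta;y^0,\nabla_yF(x^0,y^0),\dots,y^{k-1},\nabla_yF(x^{k-1},y^{k-1})\big),$$ with $(\tilde x^0,\tilde y^0)=(x^0,y^0)$. **Instance.** Let $B_x=\frac{L_x-\mu_x}4$, $B_y=\frac{L_y-\mu_y}4$, $\alpha=\frac{L_{xy}^2}{4B_xB_y}+\frac{\mu_x}{B_x}+\frac{\mu_y}{B_y}$, $\beta=\frac{\mu_x\mu_y}{B_xB_y}$, and let $q$ be a root of $1-(4+\alpha)q+(6+2\alpha+\beta)q^2-(4+\alpha)q^3+q^4=0$ with $$1-\Big(\tfrac12+\tfrac1{2\sqrt2}\sqrt{S_\theta}\Big)^{-1}<q<1-\Big(\tfrac12+\tfrac12\sqrt{S_\theta-1}\Big)^{-1}.$$ Let $A\in\mathbb R^{n\times n}$ have $A_{ij}=1$ if $i+j=n+1$, $A_{ij}=-1$ if $i+j=n+2$, and $A_{ij}=0$ otherwise;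 let $\hat b=\big((2+\alpha+\beta)q-(3+\alpha)q^2+q^3,\;q-1,\;0,\dots,0\big)^\top$, $b=\frac{2B_xB_y}{L_{xy}}A^{-1}\hat b$, and $$F(x,y)=\tfrac12x^\top(B_xA^2+\mu_xI)x+\tfrac{L_{xy}}2x^\top Ay-\tfrac12y^\top(B_yA^2+\mu_yI)y-b^\top y .$$ For orthogonal $U,V$ let $F_{U,V}(x,y)=F(Ux,Vy)$. Finally let $\mathcal H_x^m=\mathrm{Span}\{A^{2i}(Ab):0\le i\le m-2\}$ and $\mathcal H_y^m=\mathrm{Span}\{A^{2i}b:0\le i\le m-1\}$ (the zero space when the index range is empty). **Theorem.** (i) Such a $q$ exists. For every such $q$ and every integer $k\ge0$ there is $N=N(\theta,q,k)$ such that for every $n\ge N$ the function $F$ has a unique saddle point $(x^*,y^*)$, and for every algorithm $\mathcal A$ as above there are orthogonal $U,V\in\mathbb R^{n\times n}$ with $F_{U,V}\in\mathcal F(\theta)$ such that $(U^\top x^*,V^\top y^*)$ is a saddle point of $F_{U,V}$ and, when $\mathcal A$ is applied to $F_{U,V}$ from $(x^0,y^0)=(0,0)$, $$\{(x^0,y^0),\dots,(x^k,y^k)\}\subseteq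 U^\top\mathcal H_x^{2k}\times V^\top\mathcal H_y^{2k},\qquad(\tilde x^k,\tilde y^k)\in U^\top\mathcal H_x^{2k+1}\times V^\top\mathcal H_y^{2k+1},$$ $$\|\tilde x^k-U^\top x^*\|^2\ \ge\ \frac{q^{4k+2}}{16}\,\|x^*-x^0\|^2 .$$ (ii) Consequently $\Omega\big(\sqrt{S_\theta}\,\ln(1/\epsilon)\big)$ iterations are needed to output a solution with $O(\epsilon)$ duality gap, in the following sense. For every $\kappa>2$ there is $c=c(\kappa)>0$ such that for all $\theta$ as above with $S_\theta\ge\kappa$, all $q$ as above and all $C>0$ there is $\epsilon_0>0$ such that for every $\epsilon\in(0,\epsilon_0]$ there is $N$ such that for every $n\ge N$ and every algorithm $\mathcal A$ there are orthogonal $U,V$ with $F_{U,V}\in\mathcal F(\theta)$ such that, when $\mathcal A$ is applied to $F_{U,V}$ from $(0,0)$, every $k\ge0$ with $\Delta_{F_{U,V}}(\tilde x^k,\tilde y^k)\le C\epsilon$ satisfies $$k\ \ge\ c\,\sqrt{S_\theta}\,\ln(1/\epsilon).$$ (Note that $S_\theta>2$ always.) -/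

import Mathlib

noncomputable section

namespace MinMax

/-- The problem parameters `θ = (L_x, L_y, L_xy, μ_x, μ_y)`. -/
structure Params where
  Lx : ℝ
  Ly : ℝ
  Lxy : ℝ
  μx : ℝ
  μy : ℝ

/-- `L_x > μ_x > 0`, `L_y > μ_y > 0`, `L_xy > 0`. -/
structure Params.Admissible (θ : Params) : Prop where
  μx_pos : 0 < θ.μx
  μy_pos : 0 < θ.μy
  μx_lt : θ.μx < θ.Lx
  μy_lt : θ.μy < θ.Ly
  Lxy_pos : 0 < θ.Lxy

/-- `L_x/μ_x + L_xy²/(μ_x μ_y) + L_y/μ_y`. -/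
def Params.cond (θ : Params) : ℝ :=
  θ.Lx / θ.μx + θ.Lxy ^ 2 / (θ.μx * θ.μy) + θ.Ly / θ.μy

/-- `B_x = (L_x - μ_x)/4`. -/
def Params.Bx (θ : Params) : ℝ := (θ.Lx - θ.μx) / 4

/-- `B_y = (L_y - μ_y)/4`. -/
def Params.By (θ : Params) : ℝ := (θ.Ly - θ.μy) / 4

/-- `α = L_xy²/(4 B_x B_y) + μ_x/B_x + μ_y/B_y`. -/
def Params.α (θ : Params) : ℝ :=
  θ.Lxy ^ 2 / (4 * θ.Bx * θ.By) + θ.μx / θ.Bx + θ.μy / θ.By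

/-- `β = μ_x μ_y/(B_x B_y)`. -/
def Params.β (θ : Params) : ℝ := θ.μx * θ.μy / (θ.Bx * θ.By)

/-- `q` is a root of the quartic
`1 - (4+α) q + (6+2α+β) q² - (4+α) q³ + q⁴` lying in the prescribed open interval. -/
structure IsRate (θ : Params) (q : ℝ) : Prop where
  root : 1 - (4 + θ.α) * q + (6 + 2 * θ.α + θ.β) * q ^ 2 - (4 + θ.α) * q ^ 3 + q ^ 4 = 0
  lower : 1 - (1 / 2 + 1 / (2 * √2) * √θ.cond)⁻¹ < q
  upper : q < 1 - (1 / 2 + 1 / 2 * √(θ.cond - 1))⁻¹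

section General

variable {X Y : Type*} [NormedAddCommGroup X] [InnerProductSpace ℝ X] [CompleteSpace X]
  [NormedAddCommGroup Y] [InnerProductSpace ℝ Y] [CompleteSpace Y]

/-- The partial gradient `∇_x F(x, y)`. -/
def gradX (F : X → Y → ℝ) (x : X) (y : Y) : X := gradient (fun x' => F x' y) x

/-- The partial gradient `∇_y F(x, y)`. -/
def gradY (F : X → Y → ℝ) (x : X) (y : Y) : Y := gradient (fun y' => F x y') y

/-- The problem class `𝓕(L_x, L_y, L_xy, μ_x, μ_y)`. -/
structure InClass (θ : Params) (F : X → Y → ℝ) : Prop where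
  smooth : ContDiff ℝ 1 (fun p : X × Y => F p.1 p.2)
  strongConvex : ∀ y, StrongConvexOn Set.univ θ.μx (fun x => F x y)
  strongConcave : ∀ x, StrongConcaveOn Set.univ θ.μy (fun y => F x y)
  lip_xx : ∀ x₁ x₂ y, ‖gradX F x₁ y - gradX F x₂ y‖ ≤ θ.Lx * ‖x₁ - x₂‖
  lip_yy : ∀ x y₁ y₂, ‖gradY F x y₁ - gradY F x y₂‖ ≤ θ.Ly * ‖y₁ - y₂‖
  lip_xy : ∀ x y₁ y₂, ‖gradX F x y₁ - gradX F x y₂‖ ≤ θ.Lxy * ‖y₁ - y₂‖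
  lip_yx : ∀ x₁ x₂ y, ‖gradY F x₁ y - gradY F x₂ y‖ ≤ θ.Lxy * ‖x₁ - x₂‖

/-- A deterministic pure first-order algorithm. `stepX k θ h` is the mapping `𝒜_x^{k+1}`: from
the history `h i = (x^i, ∇_x F(x^i, y^i))`, `0 ≤ i ≤ k`, it returns `(x^{k+1}, x̃^{k+1})`;
similarly `stepY k` is `𝒜_y^{k+1}`. The mappings are arbitrary. -/
structure PureAlgorithm (X Y : Type*) where
  stepX : (k : ℕ) → Params → (Fin (k + 1) → X × X) → X × X
  stepY : (k : ℕ) → Params → (Fin (k + 1) → Y × Y) → Y × Y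

/-- Iterate `(x^k, y^k)` and output `(x̃^k, ỹ^k)` after `k` iterations. -/
structure State (X Y : Type*) where
  x : X
  y : Y
  outX : X
  outY : Y

/-- The iterates and outputs of `𝒜` applied to `F` from the initial solution `(x⁰, y⁰)`; the
output before the first iteration is the initial solution. -/
def PureAlgorithm.run (𝒜 : PureAlgorithm X Y) (θ : Params) (F : X → Y → ℝ) (x₀ : X) (y₀ : Y) :
    ℕ → State X Y
  | 0 => ⟨x₀, y₀, x₀, y₀⟩
  | k + 1 =>
    let s : Fin (k + 1) → State X Y := fun i => PureAlgorithm.run 𝒜 θ F x₀ y₀ i.1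
    let p := 𝒜.stepX k θ (fun i => ((s i).x, gradX F (s i).x (s i).y))
    let r := 𝒜.stepY k θ (fun i => ((s i).y, gradY F (s i).x (s i).y))
    ⟨p.1, r.1, p.2, r.2⟩
termination_by k => k
decreasing_by exact i.2

end General

section Saddle

variable {X Y : Type*}

/-- `(x*, y*)` is a saddle point of `min_x max_y F(x, y)`. -/
def IsSaddlePoint (F : X → Y → ℝ) (xs : X) (ys : Y) : Prop :=
  (∀ y, F xs y ≤ F xs ys) ∧ (∀ x, F xs ys ≤ F x ys)

/-- The duality gap `max_{y'} F(x, y') - min_{x'} F(x', y)`, as an extended real number. -/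
def dualityGap (F : X → Y → ℝ) (x : X) (y : Y) : EReal :=
  (⨆ y', (F x y' : EReal)) - ⨅ x', (F x' y : EReal)

end Saddle

/-- `ℝⁿ` with the Euclidean norm. -/
abbrev E (n : ℕ) : Type := EuclideanSpace ℝ (Fin n)

/-- The matrix `A` with ones on the antidiagonal and `-1` directly below it: in one-based indices
`A_{ij} = 1` if `i + j = n + 1` and `A_{ij} = -1` if `i + j = n + 2`. -/
def matA (n : ℕ) : Matrix (Fin n) (Fin n) ℝ :=
  Matrix.of fun i j =>
    if i.1 + j.1 + 1 = n then 1 else if i.1 + j.1 = n then -1 else 0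

/-- A square matrix acting on `ℝⁿ`. -/
def act {n : ℕ} (M : Matrix (Fin n) (Fin n) ℝ) : E n →ₗ[ℝ] E n := Matrix.toEuclideanLin M

/-- `b̂ = ((2+α+β) q - (3+α) q² + q³, q - 1, 0, …, 0)`. -/
def bHat (θ : Params) (q : ℝ) (n : ℕ) : E n :=
  WithLp.toLp 2 fun i =>
    if i.1 = 0 then (2 + θ.α + θ.β) * q - (3 + θ.α) * q ^ 2 + q ^ 3
    else if i.1 = 1 then q - 1 else 0

/-- `b = (2 B_x B_y / L_xy) A⁻¹ b̂`. -/
def vecB (θ : Params) (q : ℝ) (n : ℕ) : E n :=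
  (2 * θ.Bx * θ.By / θ.Lxy) • act (matA n)⁻¹ (bHat θ q n)

/-- The worst-case instance
`F(x,y) = ½ xᵀ(B_x A² + μ_x I)x + (L_xy/2) xᵀAy - ½ yᵀ(B_y A² + μ_y I)y - bᵀy`. -/
def worstF (θ : Params) (q : ℝ) (n : ℕ) (x y : E n) : ℝ :=
  1 / 2 * inner ℝ x (act (θ.Bx • matA n ^ 2 + θ.μx • 1) x)
    + θ.Lxy / 2 * inner ℝ x (act (matA n) y)
    - 1 / 2 * inner ℝ y (act (θ.By • matA n ^ 2 + θ.μy • 1) y)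
    - inner ℝ (vecB θ q n) y

/-- The rotated instance `F_{U,V}(x, y) = F(Ux, Vy)`. -/
def rotF (θ : Params) (q : ℝ) (n : ℕ) (U V : Matrix (Fin n) (Fin n) ℝ) (x y : E n) : ℝ :=
  worstF θ q n (act U x) (act V y)

/-- `𝓗_x^m = Span {A^{2i}(Ab) : 0 ≤ i ≤ m - 2}` (the zero space for `m ≤ 1`). -/
def Hx (θ : Params) (q : ℝ) (n m : ℕ) : Submodule ℝ (E n) :=
  Submodule.span ℝ
    {v | ∃ i : ℕ, i + 2 ≤ m ∧ v = act (matA n ^ (2 * i)) (act (matA n) (vecB θ q n))}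

/-- `𝓗_y^m = Span {A^{2i}b : 0 ≤ i ≤ m - 1}` (the zero space for `m = 0`). -/
def Hy (θ : Params) (q : ℝ) (n m : ℕ) : Submodule ℝ (E n) :=
  Submodule.span ℝ {v | ∃ i : ℕ, i + 1 ≤ m ∧ v = act (matA n ^ (2 * i)) (vecB θ q n)}

/-- The run of `𝒜` on `F_{U,V}` from the initial solution `(0, 0)`. -/
def runRot {n : ℕ} (𝒜 : PureAlgorithm (E n) (E n)) (θ : Params) (q : ℝ)
    (U V : Matrix (Fin n) (Fin n) ℝ) : ℕ → State (E n) (E n) :=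
  𝒜.run θ (rotF θ q n U V) 0 0

end MinMax

end

noncomputable section

namespace MinMax

section Coordinates

variable {n : ℕ}

/-- The `j`-th coordinate of `x`, zero-based, extended by zero for `j ≥ n`. -/
def co (x : E n) (j : ℕ) : ℝ := if h : j < n then x ⟨j, h⟩ else 0

/-- The vector of the first `n` terms of a sequence. -/
def trunc (n : ℕ) (v : ℕ → ℝ) : E n := WithLp.toLp 2 fun i => v i.1

lemma co_of_lt (x : E n) {j : ℕ} (h : j < n) : co x j = x ⟨j, h⟩ := by simp [co, h]

lemma co_of_le (x : E n) {j : ℕ} (h : n ≤ j) : co x j = 0 := by simp [co, h]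

lemma co_val (x : E n) (i : Fin n) : co x i.1 = x i := by simp [co]

lemma ext_co {x y : E n} (h : ∀ j < n, co x j = co y j) : x = y := by
  ext i
  simpa [co_val] using h i.1 i.2

lemma co_add (x y : E n) (j : ℕ) : co (x + y) j = co x j + co y j := by
  unfold co; split_ifs <;> simp

lemma co_sub (x y : E n) (j : ℕ) : co (x - y) j = co x j - co y j := by
  unfold co; split_ifs <;> simp

lemma co_smul (c : ℝ) (x : E n) (j : ℕ) : co (c • x) j = c * co x j := by
  unfold co; split_ifs <;> simp

lemma co_zero (j : ℕ) : co (0 : E n) j = 0 := by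
  unfold co; split_ifs <;> simp

lemma co_trunc (v : ℕ → ℝ) {j : ℕ} (h : j < n) : co (trunc n v) j = v j := by
  simp [co, trunc, h]

lemma norm_sq_eq_sum_co (x : E n) : ‖x‖ ^ 2 = ∑ j ∈ Finset.range n, co x j ^ 2 := by
  rw [EuclideanSpace.norm_sq_eq, ← Fin.sum_univ_eq_sum_range (fun j => co x j ^ 2)]
  simp [co_val]

end Coordinates

section Act

variable {n : ℕ}

lemma act_apply (M : Matrix (Fin n) (Fin n) ℝ) (x : E n) (i : Fin n) :
    act M x i = ∑ j, M i j * x j := by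
  simp [act, Matrix.toLpLin_apply, Matrix.mulVec, dotProduct]

lemma act_one (x : E n) : act 1 x = x := by
  simp [act]

lemma act_mul (M N : Matrix (Fin n) (Fin n) ℝ) (x : E n) : act (M * N) x = act M (act N x) := by
  simp [act, Matrix.toLpLin_apply]

lemma act_add (M N : Matrix (Fin n) (Fin n) ℝ) (x : E n) : act (M + N) x = act M x + act N x := by
  simp [act]

lemma act_smul (c : ℝ) (M : Matrix (Fin n) (Fin n) ℝ) (x : E n) : act (c • M) x = c • act M x := by
  simp [act]

lemma inner_act_left (M : Matrix (Fin n) (Fin n) ℝ) (x y : E n) :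
    inner ℝ (act M x) y = inner ℝ x (act M.transpose y) := by
  simp only [PiLp.inner_apply, act_apply, Matrix.transpose_apply]
  simp only [RCLike.inner_apply, conj_trivial, Finset.mul_sum, Finset.sum_mul]
  rw [Finset.sum_comm]
  exact Finset.sum_congr rfl fun i _ => Finset.sum_congr rfl fun j _ => by ring

lemma act_transpose_act {U : Matrix (Fin n) (Fin n) ℝ} (hU : U ∈ Matrix.orthogonalGroup (Fin n) ℝ)
    (x : E n) : act U.transpose (act U x) = x := by
  rw [← act_mul, (Matrix.mem_orthogonalGroup_iff' (Fin n) ℝ).1 hU, act_one]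

lemma act_act_transpose {U : Matrix (Fin n) (Fin n) ℝ} (hU : U ∈ Matrix.orthogonalGroup (Fin n) ℝ)
    (x : E n) : act U (act U.transpose x) = x := by
  rw [← act_mul, (Matrix.mem_orthogonalGroup_iff (Fin n) ℝ).1 hU, act_one]

lemma inner_act_act {U : Matrix (Fin n) (Fin n) ℝ} (hU : U ∈ Matrix.orthogonalGroup (Fin n) ℝ)
    (x y : E n) : inner ℝ (act U x) (act U y) = inner ℝ x y := by
  rw [inner_act_left, act_transpose_act hU]

lemma norm_act {U : Matrix (Fin n) (Fin n) ℝ} (hU : U ∈ Matrix.orthogonalGroup (Fin n) ℝ)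
    (x : E n) : ‖act U x‖ = ‖x‖ := by
  rw [norm_eq_sqrt_real_inner, norm_eq_sqrt_real_inner, inner_act_act hU]

lemma norm_act_transpose {U : Matrix (Fin n) (Fin n) ℝ}
    (hU : U ∈ Matrix.orthogonalGroup (Fin n) ℝ) (x : E n) : ‖act U.transpose x‖ = ‖x‖ := by
  rw [← norm_act hU, act_act_transpose hU]

end Act

section MatA

variable {n : ℕ}

lemma matA_transpose : (matA n).transpose = matA n := by
  ext i j
  simp [matA, add_comm]

lemma inner_matA (x y : E n) : inner ℝ (act (matA n) x) y = inner ℝ x (act (matA n) y) := by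
  rw [inner_act_left, matA_transpose]

lemma co_matA (x : E n) {j : ℕ} (hj : j < n) :
    co (act (matA n) x) j = co x (n - 1 - j) - co x (n - j) := by
  rw [co_of_lt _ hj, act_apply]
  have h : ∀ i : Fin n, matA n ⟨j, hj⟩ i * x i
      = (if i.1 = n - 1 - j then co x i.1 else 0) - (if i.1 = n - j then co x i.1 else 0) := by
    intro i
    simp only [matA, Matrix.of_apply, co_val]
    have := i.2
    split_ifs <;> first | omega | simp
  simp only [h, Finset.sum_sub_distrib]
  rw [Fin.sum_univ_eq_sum_range (fun i => if i = n - 1 - j then co x i else 0),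
    Fin.sum_univ_eq_sum_range (fun i => if i = n - j then co x i else 0)]
  rw [Finset.sum_ite_eq', Finset.sum_ite_eq']
  rw [if_pos (by simp; omega)]
  by_cases h0 : n - j < n
  · rw [if_pos (by simpa using h0)]
  · rw [if_neg (by simpa using h0), co_of_le x (not_lt.1 h0)]

lemma co_matA_matA_zero (x : E n) (hn : 0 < n) :
    co (act (matA n) (act (matA n) x)) 0 = co x 0 - co x 1 := by
  rw [co_matA _ hn, co_of_le _ (by simp : n ≤ n - 0), co_matA _ (by omega)]
  have h1 : n - 1 - (n - 1 - 0) = 0 := by omega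
  have h2 : n - (n - 1 - 0) = 1 := by omega
  rw [h1, h2, sub_zero]

lemma co_matA_matA_succ (x : E n) {j : ℕ} (hj : j + 1 < n) :
    co (act (matA n) (act (matA n) x)) (j + 1) = 2 * co x (j + 1) - co x j - co x (j + 2) := by
  rw [co_matA _ hj, co_matA _ (by omega), co_matA _ (by omega)]
  have h1 : n - 1 - (n - 1 - (j + 1)) = j + 1 := by omega
  have h2 : n - (n - 1 - (j + 1)) = j + 2 := by omega
  have h3 : n - 1 - (n - (j + 1)) = j := by omega
  have h4 : n - (n - (j + 1)) = j + 1 := by omega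
  rw [h1, h2, h3, h4]
  ring

lemma norm_matA_le (x : E n) : ‖act (matA n) x‖ ≤ 2 * ‖x‖ := by
  refine le_of_sq_le_sq ?_ (by positivity)
  rw [mul_pow, norm_sq_eq_sum_co, norm_sq_eq_sum_co x]
  have h1 : ∑ j ∈ Finset.range n, co (act (matA n) x) j ^ 2
      ≤ ∑ j ∈ Finset.range n, (2 * co x (n - 1 - j) ^ 2 + 2 * co x (n - j) ^ 2) := by
    refine Finset.sum_le_sum fun j hj => ?_
    rw [co_matA x (Finset.mem_range.1 hj)]
    nlinarith [sq_nonneg (co x (n - 1 - j) + co x (n - j))]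
  have h2 : ∑ j ∈ Finset.range n, co x (n - 1 - j) ^ 2 = ∑ j ∈ Finset.range n, co x j ^ 2 :=
    Finset.sum_range_reflect (fun j => co x j ^ 2) n
  have h3 : ∑ j ∈ Finset.range n, co x (n - j) ^ 2 ≤ ∑ j ∈ Finset.range n, co x j ^ 2 := by
    have e1 : ∑ j ∈ Finset.range n, co x (n - j) ^ 2
        = ∑ j ∈ Finset.range n, co x (j + 1) ^ 2 := by
      rw [← Finset.sum_range_reflect (fun j => co x (j + 1) ^ 2) n]
      refine Finset.sum_congr rfl fun j hj => ?_
      have := Finset.mem_range.1 hj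
      rw [show n - 1 - j + 1 = n - j by omega]
    have e2 := Finset.sum_range_succ' (fun j => co x j ^ 2) n
    rw [Finset.sum_range_succ, co_of_le x le_rfl] at e2
    rw [e1]
    nlinarith [sq_nonneg (co x 0)]
  rw [Finset.sum_add_distrib, ← Finset.mul_sum, ← Finset.mul_sum] at h1
  linarith

lemma matA_injective : Function.Injective (act (matA n)) := by
  rw [← LinearMap.ker_eq_bot, LinearMap.ker_eq_bot']
  intro x hx
  have h : ∀ j ≤ n, co x (n - j) = 0 := by
    intro j
    induction j with
    | zero => intro _; exact co_of_le x (by simp)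
    | succ j ih =>
      intro hj
      have h1 := co_matA x (j := j) (by omega)
      rw [hx, co_zero, ih (by omega), sub_zero] at h1
      rw [show n - (j + 1) = n - 1 - j by omega, ← h1]
  refine ext_co fun j hj => ?_
  have := h (n - j) (by omega)
  rwa [show n - (n - j) = j by omega, ← co_zero (n := n) j] at this

lemma isUnit_matA : IsUnit (matA n) := by
  rw [← Matrix.mulVec_injective_iff_isUnit]
  intro v w h
  have := @matA_injective n (WithLp.toLp 2 v) (WithLp.toLp 2 w) (by
    simp only [act, Matrix.toLpLin_apply]
    exact congrArg (WithLp.toLp 2) h)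
  exact (WithLp.toLp_injective 2) this

lemma matA_act_inv (x : E n) : act (matA n) (act (matA n)⁻¹ x) = x := by
  rw [← act_mul, Matrix.mul_nonsing_inv _ ((Matrix.isUnit_iff_isUnit_det _).1 isUnit_matA), act_one]

lemma act_matA_pow_two_mul (i : ℕ) (x : E n) :
    act (matA n ^ (2 * (i + 1))) x = act (matA n) (act (matA n) (act (matA n ^ (2 * i)) x)) := by
  rw [← act_mul, ← act_mul]
  congr 2
  rw [show 2 * (i + 1) = 2 + 2 * i by ring, pow_add, pow_two]

lemma act_matA_pow_comm (i : ℕ) (x : E n) :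
    act (matA n) (act (matA n ^ i) x) = act (matA n ^ i) (act (matA n) x) := by
  rw [← act_mul, ← act_mul, ← pow_succ, ← pow_succ']

lemma matA_vecB (θ : Params) (q : ℝ) :
    act (matA n) (vecB θ q n) = (2 * θ.Bx * θ.By / θ.Lxy) • bHat θ q n := by
  rw [vecB, map_smul, matA_act_inv]

end MatA

section Quadratic

variable {X : Type*} [NormedAddCommGroup X] [InnerProductSpace ℝ X]

lemma hasGradientAt_of_quadratic_remainder [CompleteSpace X] {f Q : X → ℝ} {x g : X} {C : ℝ}
    (hf : ∀ h, f (x + h) = f x + inner ℝ g h + Q h) (hQ : ∀ h, |Q h| ≤ C * ‖h‖ ^ 2) :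
    HasGradientAt f g x := by
  rw [hasGradientAt_iff_isLittleO_nhds_zero]
  have h1 : (fun h : X => f (x + h) - f x - inner ℝ g h) = Q := by
    funext h; rw [hf]; ring
  rw [h1]
  have h2 : Q =O[nhds 0] fun h : X => ‖h‖ ^ 2 :=
    Asymptotics.IsBigO.of_bound C (Filter.Eventually.of_forall fun h => by
      rw [Real.norm_eq_abs, Real.norm_eq_abs, abs_of_nonneg (sq_nonneg ‖h‖)]
      exact hQ h)
  exact h2.trans_isLittleO (Asymptotics.isLittleO_norm_pow_id one_lt_two)

lemma strongConvexOn_of_quadratic_lower_bound {f : X → ℝ} {g : X → X} {m : ℝ}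
    (hf : ∀ x h, f x + inner ℝ (g x) h + m / 2 * ‖h‖ ^ 2 ≤ f (x + h)) :
    StrongConvexOn Set.univ m f := by
  refine ⟨convex_univ, fun x _ y _ a b ha hb hab => ?_⟩
  set z := a • x + b • y with hz
  have hx : x - z = b • (x - y) := by
    obtain rfl : a = 1 - b := by linarith
    rw [hz]
    module
  have hy : y - z = (-a) • (x - y) := by
    obtain rfl : b = 1 - a := by linarith
    rw [hz]
    module
  have h1 := hf z (x - z)
  have h2 := hf z (y - z)
  rw [add_sub_cancel, hx, inner_smul_right, norm_smul, mul_pow, Real.norm_eq_abs, sq_abs] at h1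
  rw [add_sub_cancel, hy, inner_smul_right, norm_smul, mul_pow, Real.norm_eq_abs, sq_abs] at h2
  have h3 := add_le_add (mul_le_mul_of_nonneg_left h1 ha) (mul_le_mul_of_nonneg_left h2 hb)
  obtain rfl : b = 1 - a := by linarith
  simp only [smul_eq_mul]
  linear_combination h3

end Quadratic

section Gradient

variable {n : ℕ}

/-- The partial gradient of the worst-case instance in its first argument. -/
def gx (θ : Params) (u v : E n) : E n :=
  θ.Bx • act (matA n) (act (matA n) u) + θ.μx • u + (θ.Lxy / 2) • act (matA n) v

/-- The partial gradient of the worst-case instance in its second argument. -/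
def gy (θ : Params) (q : ℝ) (u v : E n) : E n :=
  (θ.Lxy / 2) • act (matA n) u - θ.By • act (matA n) (act (matA n) v) - θ.μy • v - vecB θ q n

lemma worstF_eq (θ : Params) (q : ℝ) (u v : E n) :
    worstF θ q n u v = θ.Bx / 2 * ‖act (matA n) u‖ ^ 2 + θ.μx / 2 * ‖u‖ ^ 2
      + θ.Lxy / 2 * inner ℝ u (act (matA n) v)
      - (θ.By / 2 * ‖act (matA n) v‖ ^ 2 + θ.μy / 2 * ‖v‖ ^ 2) - inner ℝ (vecB θ q n) v := by
  simp only [worstF, act_add, act_smul, act_one, pow_two (matA n), act_mul, inner_add_right,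
    inner_smul_right, ← inner_matA, real_inner_self_eq_norm_sq]
  ring

lemma worstF_add_left (θ : Params) (q : ℝ) (u v h : E n) :
    worstF θ q n (u + h) v = worstF θ q n u v + inner ℝ (gx θ u v) h
      + (θ.Bx / 2 * ‖act (matA n) h‖ ^ 2 + θ.μx / 2 * ‖h‖ ^ 2) := by
  simp only [worstF_eq, gx, map_add, norm_add_sq_real, inner_add_left, real_inner_smul_left,
    inner_matA]
  rw [← inner_matA v h, real_inner_comm h (act (matA n) v)]
  ring

lemma worstF_add_right (θ : Params) (q : ℝ) (u v h : E n) :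
    worstF θ q n u (v + h) = worstF θ q n u v + inner ℝ (gy θ q u v) h
      - (θ.By / 2 * ‖act (matA n) h‖ ^ 2 + θ.μy / 2 * ‖h‖ ^ 2) := by
  simp only [worstF_eq, gy, map_add, norm_add_sq_real, inner_sub_left, inner_add_right,
    real_inner_smul_left, inner_matA]
  ring

lemma norm_matA_sq_le (x : E n) : ‖act (matA n) x‖ ^ 2 ≤ 4 * ‖x‖ ^ 2 := by
  have := pow_le_pow_left₀ (norm_nonneg _) (norm_matA_le x) 2
  linarith [mul_pow 2 ‖x‖ 2]

lemma abs_quadratic_le {B m : ℝ} (hB : 0 < B) (hm : 0 < m) (h : E n) :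
    |B / 2 * ‖act (matA n) h‖ ^ 2 + m / 2 * ‖h‖ ^ 2| ≤ (2 * B + m / 2) * ‖h‖ ^ 2 := by
  rw [abs_of_nonneg (by positivity)]
  nlinarith [norm_matA_sq_le h]

variable {θ : Params}

lemma Params.Admissible.Bx_pos (hθ : θ.Admissible) : 0 < θ.Bx := by
  have := hθ.μx_lt
  unfold Params.Bx; linarith

lemma Params.Admissible.By_pos (hθ : θ.Admissible) : 0 < θ.By := by
  have := hθ.μy_lt
  unfold Params.By; linarith

variable {U V : Matrix (Fin n) (Fin n) ℝ}

lemma rotF_add_left (q : ℝ) (x y h : E n) :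
    rotF θ q n U V (x + h) y = rotF θ q n U V x y
      + inner ℝ (act U.transpose (gx θ (act U x) (act V y))) h
      + (θ.Bx / 2 * ‖act (matA n) (act U h)‖ ^ 2 + θ.μx / 2 * ‖act U h‖ ^ 2) := by
  rw [rotF, map_add, worstF_add_left, rotF, inner_act_left, Matrix.transpose_transpose]

lemma rotF_add_right (q : ℝ) (x y h : E n) :
    rotF θ q n U V x (y + h) = rotF θ q n U V x y
      + inner ℝ (act V.transpose (gy θ q (act U x) (act V y))) h
      - (θ.By / 2 * ‖act (matA n) (act V h)‖ ^ 2 + θ.μy / 2 * ‖act V h‖ ^ 2) := by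
  rw [rotF, map_add, worstF_add_right, rotF, inner_act_left, Matrix.transpose_transpose]

lemma gradX_rotF (hθ : θ.Admissible) (q : ℝ) (hU : U ∈ Matrix.orthogonalGroup (Fin n) ℝ)
    (x y : E n) :
    gradX (rotF θ q n U V) x y = act U.transpose (gx θ (act U x) (act V y)) :=
  (hasGradientAt_of_quadratic_remainder (rotF_add_left q x y) fun h => by
    have := abs_quadratic_le hθ.Bx_pos hθ.μx_pos (act U h)
    rw [norm_act hU] at this ⊢
    exact this).gradient

lemma gradY_rotF (hθ : θ.Admissible) (q : ℝ) (hV : V ∈ Matrix.orthogonalGroup (Fin n) ℝ)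
    (x y : E n) :
    gradY (rotF θ q n U V) x y = act V.transpose (gy θ q (act U x) (act V y)) :=
  (hasGradientAt_of_quadratic_remainder
    (fun h => (rotF_add_right q x y h).trans (sub_eq_add_neg _ _)) fun h => by
    have := abs_quadratic_le hθ.By_pos hθ.μy_pos (act V h)
    rw [norm_act hV] at this ⊢
    rwa [abs_neg]).gradient

lemma norm_matA_matA_le {B m L : ℝ} (hB : 0 < B) (hm : 0 < m) (hL : 4 * B + m = L) (x : E n) :
    ‖B • act (matA n) (act (matA n) x) + m • x‖ ≤ L * ‖x‖ := by
  refine (norm_add_le _ _).trans ?_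
  rw [norm_smul, norm_smul, Real.norm_of_nonneg hB.le, Real.norm_of_nonneg hm.le, ← hL]
  nlinarith [norm_matA_le x, norm_matA_le (act (matA n) x)]

lemma norm_smul_matA_le {L : ℝ} (hL : 0 < L) (x : E n) :
    ‖(L / 2) • act (matA n) x‖ ≤ L * ‖x‖ := by
  rw [norm_smul, Real.norm_of_nonneg (by positivity)]
  nlinarith [norm_matA_le x]

lemma contDiff_act (M : Matrix (Fin n) (Fin n) ℝ) : ContDiff ℝ 1 (act M) :=
  (LinearMap.toContinuousLinearMap (act M)).contDiff

lemma contDiff_rotF (θ : Params) (q : ℝ) (U V : Matrix (Fin n) (Fin n) ℝ) :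
    ContDiff ℝ 1 (fun p : E n × E n => rotF θ q n U V p.1 p.2) := by
  have hu : ContDiff ℝ 1 (fun p : E n × E n => act U p.1) :=
    (contDiff_act U).comp contDiff_fst
  have hv : ContDiff ℝ 1 (fun p : E n × E n => act V p.2) :=
    (contDiff_act V).comp contDiff_snd
  have hau := (contDiff_act (matA n)).comp hu
  have hav := (contDiff_act (matA n)).comp hv
  simp only [rotF, worstF_eq]
  exact ((((contDiff_const.mul (hau.norm_sq ℝ)).add (contDiff_const.mul (hu.norm_sq ℝ))).add
    (contDiff_const.mul (hu.inner ℝ hav))).sub ((contDiff_const.mul (hav.norm_sq ℝ)).add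
      (contDiff_const.mul (hv.norm_sq ℝ)))).sub (contDiff_const.inner ℝ hv)

lemma inClass_rotF (hθ : θ.Admissible) (q : ℝ) (hU : U ∈ Matrix.orthogonalGroup (Fin n) ℝ)
    (hV : V ∈ Matrix.orthogonalGroup (Fin n) ℝ) : InClass θ (rotF θ q n U V) where
  smooth := contDiff_rotF θ q U V
  strongConvex y := strongConvexOn_of_quadratic_lower_bound
    (g := fun x => act U.transpose (gx θ (act U x) (act V y))) fun x h => by
      have := hθ.Bx_pos
      rw [rotF_add_left q, norm_act hU]
      have : 0 ≤ θ.Bx / 2 * ‖act (matA n) (act U h)‖ ^ 2 := by positivity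
      linarith
  strongConcave x := by
    rw [StrongConcaveOn, ← neg_neg (fun y => rotF θ q n U V x y)]
    refine UniformConvexOn.neg <| strongConvexOn_of_quadratic_lower_bound
      (g := fun y => -act V.transpose (gy θ q (act U x) (act V y))) fun y h => ?_
    have := hθ.By_pos
    simp only [Pi.neg_apply]
    rw [rotF_add_right q, norm_act hV, inner_neg_left]
    have : 0 ≤ θ.By / 2 * ‖act (matA n) (act V h)‖ ^ 2 := by positivity
    linarith
  lip_xx x₁ x₂ y := by
    rw [gradX_rotF hθ q hU, gradX_rotF hθ q hU, ← map_sub, norm_act_transpose hU,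
      ← norm_act hU (x₁ - x₂)]
    refine le_of_eq_of_le (congrArg norm ?_) (norm_matA_matA_le hθ.Bx_pos hθ.μx_pos
      (by unfold Params.Bx; ring) (act U (x₁ - x₂)))
    simp only [gx, map_sub]
    module
  lip_yy x y₁ y₂ := by
    rw [gradY_rotF hθ q hV, gradY_rotF hθ q hV, ← map_sub, norm_act_transpose hV,
      ← norm_act hV (y₁ - y₂), ← norm_neg]
    refine le_of_eq_of_le (congrArg norm ?_) (norm_matA_matA_le hθ.By_pos hθ.μy_pos
      (by unfold Params.By; ring) (act V (y₁ - y₂)))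
    simp only [gy, map_sub]
    module
  lip_xy x y₁ y₂ := by
    rw [gradX_rotF hθ q hU, gradX_rotF hθ q hU, ← map_sub, norm_act_transpose hU,
      ← norm_act hV (y₁ - y₂)]
    refine le_of_eq_of_le (congrArg norm ?_) (norm_smul_matA_le hθ.Lxy_pos (act V (y₁ - y₂)))
    simp only [gx, map_sub]
    module
  lip_yx x₁ x₂ y := by
    rw [gradY_rotF hθ q hV, gradY_rotF hθ q hV, ← map_sub, norm_act_transpose hV,
      ← norm_act hU (x₁ - x₂)]
    refine le_of_eq_of_le (congrArg norm ?_) (norm_smul_matA_le hθ.Lxy_pos (act U (x₁ - x₂)))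
    simp only [gy, map_sub]
    module

end Gradient

section Saddle

variable {n : ℕ} {θ : Params} {q : ℝ}

/-- The operator `A⁴ + α A² + β`, whose preimage of `b̂` is the first half of the saddle point. -/
def opG (θ : Params) (n : ℕ) : E n →ₗ[ℝ] E n :=
  act (matA n) ∘ₗ act (matA n) ∘ₗ act (matA n) ∘ₗ act (matA n)
    + θ.α • (act (matA n) ∘ₗ act (matA n)) + θ.β • LinearMap.id

lemma opG_apply (x : E n) : opG θ n x =
    act (matA n) (act (matA n) (act (matA n) (act (matA n) x)))
      + θ.α • act (matA n) (act (matA n) x) + θ.β • x := rfl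

lemma Params.Admissible.α_pos (hθ : θ.Admissible) : 0 < θ.α := by
  have h1 := hθ.Bx_pos
  have h2 := hθ.By_pos
  have h3 := hθ.μx_pos
  have h4 := hθ.μy_pos
  have h5 := hθ.Lxy_pos
  unfold Params.α
  positivity

lemma Params.Admissible.β_pos (hθ : θ.Admissible) : 0 < θ.β := by
  have h1 := hθ.Bx_pos
  have h2 := hθ.By_pos
  have h3 := hθ.μx_pos
  have h4 := hθ.μy_pos
  unfold Params.β
  positivity

lemma mul_norm_le_norm_opG (hθ : θ.Admissible) (x : E n) : θ.β * ‖x‖ ≤ ‖opG θ n x‖ := by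
  have h : inner ℝ x (opG θ n x) = ‖act (matA n) (act (matA n) x)‖ ^ 2
      + θ.α * ‖act (matA n) x‖ ^ 2 + θ.β * ‖x‖ ^ 2 := by
    simp only [opG_apply, inner_add_right, inner_smul_right, ← inner_matA,
      real_inner_self_eq_norm_sq]
  have h1 := real_inner_le_norm x (opG θ n x)
  have h2 : 0 ≤ θ.α * ‖act (matA n) x‖ ^ 2 := mul_nonneg hθ.α_pos.le (sq_nonneg _)
  have h3 : ‖x‖ * (θ.β * ‖x‖) ≤ ‖x‖ * ‖opG θ n x‖ := by
    nlinarith [sq_nonneg ‖act (matA n) (act (matA n) x)‖]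
  rcases (norm_nonneg x).eq_or_lt with h0 | h0
  · rw [← h0, mul_zero]; exact norm_nonneg _
  · exact le_of_mul_le_mul_left h3 h0

lemma opG_surjective (hθ : θ.Admissible) : Function.Surjective (opG θ n) := by
  rw [← LinearMap.injective_iff_surjective, ← LinearMap.ker_eq_bot, LinearMap.ker_eq_bot']
  intro x hx
  have h := mul_norm_le_norm_opG hθ x
  rw [hx, norm_zero] at h
  have := hθ.β_pos
  exact norm_le_zero_iff.1 (nonpos_of_mul_nonpos_right h this)

lemma exists_stationary (hθ : θ.Admissible) (q : ℝ) (n : ℕ) :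
    ∃ xs ys : E n, opG θ n xs = bHat θ q n ∧ gx θ xs ys = 0 ∧ gy θ q xs ys = 0 := by
  obtain ⟨xs, hxs⟩ := opG_surjective hθ (bHat θ q n)
  set w := θ.Bx • act (matA n) (act (matA n) xs) + θ.μx • xs with hw
  have hL := hθ.Lxy_pos.ne'
  have hBx := hθ.Bx_pos.ne'
  have hBy := hθ.By_pos.ne'
  have hay : act (matA n) ((-(2 / θ.Lxy)) • act (matA n)⁻¹ w) = (-(2 / θ.Lxy)) • w := by
    rw [map_smul, matA_act_inv]
  refine ⟨xs, (-(2 / θ.Lxy)) • act (matA n)⁻¹ w, hxs, ?_, matA_injective ?_⟩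
  · rw [gx, hay, ← hw, smul_smul]
    match_scalars <;> field_simp <;> ring
  · simp only [gy, map_sub, map_smul, map_zero, matA_vecB, ← hxs, opG_apply, matA_act_inv, hw,
      map_add, Params.α, Params.β]
    match_scalars <;> field_simp <;> ring

lemma worstF_left_lower_bound (hθ : θ.Admissible) {xs ys : E n} (h : gx θ xs ys = 0) (x : E n) :
    worstF θ q n xs ys + θ.μx / 2 * ‖x - xs‖ ^ 2 ≤ worstF θ q n x ys := by
  have h1 := worstF_add_left θ q xs ys (x - xs)
  have h2 := hθ.Bx_pos
  have h3 : 0 ≤ θ.Bx / 2 * ‖act (matA n) (x - xs)‖ ^ 2 := by positivity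
  rw [add_sub_cancel, h, inner_zero_left] at h1
  linarith

lemma worstF_right_upper_bound (hθ : θ.Admissible) {xs ys : E n} (h : gy θ q xs ys = 0) (y : E n) :
    worstF θ q n xs y ≤ worstF θ q n xs ys - θ.μy / 2 * ‖y - ys‖ ^ 2 := by
  have h1 := worstF_add_right θ q xs ys (y - ys)
  have h2 := hθ.By_pos
  have h3 : 0 ≤ θ.By / 2 * ‖act (matA n) (y - ys)‖ ^ 2 := by positivity
  rw [add_sub_cancel, h, inner_zero_left] at h1
  linarith

lemma isSaddlePoint_of_stationary (hθ : θ.Admissible) {xs ys : E n} (hx : gx θ xs ys = 0)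
    (hy : gy θ q xs ys = 0) : IsSaddlePoint (worstF θ q n) xs ys := by
  have h1 := hθ.μx_pos
  have h2 := hθ.μy_pos
  refine ⟨fun y => (worstF_right_upper_bound hθ hy y).trans ?_,
    fun x => le_trans ?_ (worstF_left_lower_bound hθ hx x)⟩
  · exact sub_le_self _ (by positivity)
  · exact le_add_of_nonneg_right (by positivity)

lemma eq_of_isSaddlePoint (hθ : θ.Admissible) {xs ys x y : E n} (hx : gx θ xs ys = 0)
    (hy : gy θ q xs ys = 0) (h : IsSaddlePoint (worstF θ q n) x y) : x = xs ∧ y = ys := by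
  have h1 := hθ.μx_pos
  have h2 := hθ.μy_pos
  have h3 := worstF_left_lower_bound (q := q) hθ hx x
  have h4 := worstF_right_upper_bound hθ hy y
  have h5 := h.1 ys
  have h6 := h.2 xs
  have h7 : 0 ≤ θ.μx / 2 * ‖x - xs‖ ^ 2 := by positivity
  have h8 : 0 ≤ θ.μy / 2 * ‖y - ys‖ ^ 2 := by positivity
  have h9 : θ.μx / 2 * ‖x - xs‖ ^ 2 = 0 := by linarith
  have h10 : θ.μy / 2 * ‖y - ys‖ ^ 2 = 0 := by linarith
  constructor
  · simpa [h1.ne', sub_eq_zero] using h9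
  · simpa [h2.ne', sub_eq_zero] using h10

variable {U V : Matrix (Fin n) (Fin n) ℝ}

lemma isSaddlePoint_rotF (hU : U ∈ Matrix.orthogonalGroup (Fin n) ℝ)
    (hV : V ∈ Matrix.orthogonalGroup (Fin n) ℝ) {xs ys : E n}
    (h : IsSaddlePoint (worstF θ q n) xs ys) :
    IsSaddlePoint (rotF θ q n U V) (act U.transpose xs) (act V.transpose ys) := by
  constructor
  · intro y
    simpa only [rotF, act_act_transpose hU, act_act_transpose hV] using h.1 (act V y)
  · intro x
    simpa only [rotF, act_act_transpose hU, act_act_transpose hV] using h.2 (act U x)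

lemma dualityGap_rotF_lower_bound (hθ : θ.Admissible) (hU : U ∈ Matrix.orthogonalGroup (Fin n) ℝ)
    (hV : V ∈ Matrix.orthogonalGroup (Fin n) ℝ) {xs ys : E n} (hx : gx θ xs ys = 0)
    (hy : gy θ q xs ys = 0) (x y : E n) :
    ((θ.μx / 2 * ‖x - act U.transpose xs‖ ^ 2 : ℝ) : EReal) ≤ dualityGap (rotF θ q n U V) x y := by
  have h1 := worstF_left_lower_bound (q := q) hθ hx (act U x)
  have h2 := (isSaddlePoint_of_stationary hθ hx hy).1 (act V y)
  rw [← act_act_transpose hU xs, ← map_sub, norm_act hU, act_act_transpose hU] at h1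
  have h3 : ((rotF θ q n U V x (act V.transpose ys) : ℝ) : EReal)
      ≤ ⨆ y', (rotF θ q n U V x y' : EReal) :=
    le_iSup (fun y' => (rotF θ q n U V x y' : EReal)) _
  have h4 : (⨅ x', (rotF θ q n U V x' y : EReal))
      ≤ ((rotF θ q n U V (act U.transpose xs) y : ℝ) : EReal) :=
    iInf_le (fun x' => (rotF θ q n U V x' y : EReal)) _
  refine le_trans ?_ (EReal.sub_le_sub h3 h4)
  rw [← EReal.coe_sub, EReal.coe_le_coe_iff]
  simp only [rotF, act_act_transpose hU, act_act_transpose hV]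
  linarith

end Saddle

section Decay

variable {n : ℕ} {θ : Params} {q : ℝ}

/-- The action of `A²` on an infinite sequence, without the boundary condition at the far end. -/
def seqD (v : ℕ → ℝ) : ℕ → ℝ
  | 0 => v 0 - v 1
  | j + 1 => 2 * v (j + 1) - v j - v (j + 2)

/-- The last standard basis vector. -/
def lastVec (n : ℕ) : E n := trunc n fun j => if j + 1 = n then 1 else 0

lemma norm_lastVec_le : ‖lastVec n‖ ≤ 1 := by
  refine le_of_sq_le_sq ?_ zero_le_one
  rw [norm_sq_eq_sum_co]
  rcases n with _ | n
  · simp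
  rw [Finset.sum_eq_single n]
  · rw [lastVec, co_trunc _ (Nat.lt_succ_self n)]; simp
  · intro j hj hne
    rw [lastVec, co_trunc _ (Finset.mem_range.1 hj)]
    simp [hne]
  · simp

lemma matA_matA_trunc (v : ℕ → ℝ) :
    act (matA n) (act (matA n) (trunc n v)) = trunc n (seqD v) + v n • lastVec n := by
  refine ext_co fun j hj => ?_
  rw [co_add, co_smul, co_trunc _ hj, lastVec, co_trunc _ hj]
  have key : co (trunc n v) (j + 1) = v (j + 1) - v n * (if j + 1 = n then 1 else 0) := by
    by_cases h : j + 1 = n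
    · rw [co_of_le _ h.ge, if_pos h, h]; ring
    · rw [co_trunc _ (by omega), if_neg h]; ring
  rcases j with _ | j
  · rw [co_matA_matA_zero _ hj, co_trunc _ hj, key, seqD]; ring
  · rw [co_matA_matA_succ _ hj, co_trunc _ hj, co_trunc _ (by omega), key, seqD]; ring

lemma seqD_geom_succ (j : ℕ) :
    seqD (fun i => q ^ (i + 1)) (j + 1) = -(q ^ (j + 1) * (1 - q) ^ 2) := by
  simp only [seqD]; ring

lemma IsRate.residual (hq : IsRate θ q) :
    trunc n (seqD (seqD fun i => q ^ (i + 1))) + θ.α • trunc n (seqD fun i => q ^ (i + 1))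
      + θ.β • trunc n (fun i => q ^ (i + 1)) = bHat θ q n := by
  have hr := hq.root
  refine ext_co fun j hj => ?_
  have hb : co (bHat θ q n) j = if j = 0 then (2 + θ.α + θ.β) * q - (3 + θ.α) * q ^ 2 + q ^ 3
    else if j = 1 then q - 1 else 0 := co_of_lt _ hj
  rw [hb, co_add, co_add, co_smul, co_smul, co_trunc _ hj, co_trunc _ hj, co_trunc _ hj]
  rcases j with _ | _ | j
  · simp only [seqD, if_pos]; ring
  · simp only [seqD]
    norm_num
    linear_combination hr
  · simp only [seqD]
    rw [if_neg (by omega), if_neg (by omega)]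
    linear_combination q ^ (j + 1) * hr

lemma opG_geom (hq : IsRate θ q) :
    opG θ n (trunc n fun i => q ^ (i + 1)) = bHat θ q n
      + (q ^ (n + 1) • act (matA n) (act (matA n) (lastVec n))
        + (seqD (fun i => q ^ (i + 1)) n + θ.α * q ^ (n + 1)) • lastVec n) := by
  rw [opG_apply, matA_matA_trunc, map_add, map_add, matA_matA_trunc, map_smul, map_smul,
    ← hq.residual]
  module

lemma norm_sub_geom_le (hθ : θ.Admissible) (hq : IsRate θ q) (h0 : 0 < q) (h1 : q < 1)
    (hn : 0 < n) {xs : E n} (hxs : opG θ n xs = bHat θ q n) :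
    ‖xs - trunc n fun i => q ^ (i + 1)‖ ≤ (5 + θ.α) / θ.β * q ^ n := by
  have hα := hθ.α_pos
  have hβ := hθ.β_pos
  have h := mul_norm_le_norm_opG hθ (xs - trunc n fun i => q ^ (i + 1))
  rw [map_sub, hxs, opG_geom hq, sub_add_cancel_left, norm_neg] at h
  have hp : q ^ (n + 1) ≤ q ^ n := pow_le_pow_of_le_one h0.le h1.le (Nat.le_succ n)
  have hp0 : 0 < q ^ n := pow_pos h0 n
  have hp1 : 0 < q ^ (n + 1) := pow_pos h0 _
  have e1 : ‖q ^ (n + 1) • act (matA n) (act (matA n) (lastVec n))‖ ≤ 4 * q ^ n := by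
    rw [norm_smul, Real.norm_of_nonneg hp1.le]
    have : ‖act (matA n) (act (matA n) (lastVec n))‖ ≤ 4 := by
      have a1 := norm_matA_le (act (matA n) (lastVec n))
      have a2 := norm_matA_le (lastVec n)
      have a3 := norm_lastVec_le (n := n)
      linarith
    nlinarith
  have e2 : ‖(seqD (fun i => q ^ (i + 1)) n + θ.α * q ^ (n + 1)) • lastVec n‖
      ≤ (1 + θ.α) * q ^ n := by
    obtain ⟨m, rfl⟩ : ∃ m, n = m + 1 := ⟨n - 1, by omega⟩
    rw [norm_smul, seqD_geom_succ, Real.norm_eq_abs]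
    have h2 : (1 - q) ^ 2 ≤ 1 := by nlinarith
    have h3 : |-(q ^ (m + 1) * (1 - q) ^ 2) + θ.α * q ^ (m + 1 + 1)| ≤ (1 + θ.α) * q ^ (m + 1) := by
      rw [abs_le]
      constructor <;> nlinarith [sq_nonneg (1 - q), mul_pos hα hp1, mul_pos hα hp0]
    calc _ ≤ (1 + θ.α) * q ^ (m + 1) * 1 :=
          mul_le_mul h3 norm_lastVec_le (norm_nonneg _) (by positivity)
      _ = _ := mul_one _
  have e3 := (h.trans (norm_add_le _ _)).trans (add_le_add e1 e2)
  rw [div_mul_eq_mul_div, le_div_iff₀ hβ]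
  linarith

lemma norm_sub_sq_ge_tail {m : ℕ} (hmn : m ≤ n) {x z : E n} (hz : ∀ j, m ≤ j → co z j = 0) :
    ∑ j ∈ Finset.range (n - m), co x (m + j) ^ 2 ≤ ‖z - x‖ ^ 2 := by
  obtain ⟨d, rfl⟩ : ∃ d, n = m + d := ⟨n - m, by omega⟩
  rw [norm_sq_eq_sum_co, Finset.sum_range_add, Nat.add_sub_cancel_left]
  have h : ∀ j ∈ Finset.range d, co (z - x) (m + j) ^ 2 = co x (m + j) ^ 2 := by
    intro j _
    rw [co_sub, hz _ (Nat.le_add_right m j)]; ring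
  rw [Finset.sum_congr rfl h]
  exact le_add_of_nonneg_left (Finset.sum_nonneg fun _ _ => sq_nonneg _)

lemma geom_tail_lower_bound (h0 : 0 < q) (h1 : q < 1) {m : ℕ} (hmn : 2 * m ≤ n) {z : E n}
    (hz : ∀ j, m ≤ j → co z j = 0) :
    q ^ m / 2 * ‖trunc n fun i => q ^ (i + 1)‖ ≤ ‖z - trunc n fun i => q ^ (i + 1)‖ := by
  refine le_of_sq_le_sq (le_trans ?_ (norm_sub_sq_ge_tail (by omega) hz)) (norm_nonneg _)
  obtain ⟨d, rfl⟩ : ∃ d, n = d + m := ⟨n - m, by omega⟩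
  have hs : ∀ r, ∑ j ∈ Finset.range r, (q ^ (j + 1)) ^ 2 ≥ 0 := fun r =>
    Finset.sum_nonneg fun _ _ => sq_nonneg _
  have e1 : ∑ j ∈ Finset.range (d + m - m), co (trunc (d + m) fun i => q ^ (i + 1)) (m + j) ^ 2
      = (q ^ m) ^ 2 * ∑ j ∈ Finset.range d, (q ^ (j + 1)) ^ 2 := by
    rw [Nat.add_sub_cancel, Finset.mul_sum]
    refine Finset.sum_congr rfl fun j hj => ?_
    rw [co_trunc _ (by have := Finset.mem_range.1 hj; omega)]
    ring
  have e2 : ‖trunc (d + m) fun i => q ^ (i + 1)‖ ^ 2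
      ≤ 2 * ∑ j ∈ Finset.range d, (q ^ (j + 1)) ^ 2 := by
    have : ‖trunc (d + m) fun i => q ^ (i + 1)‖ ^ 2
        = ∑ j ∈ Finset.range (d + m), (q ^ (j + 1)) ^ 2 := by
      rw [norm_sq_eq_sum_co]
      exact Finset.sum_congr rfl fun j hj => by rw [co_trunc _ (Finset.mem_range.1 hj)]
    rw [this, Finset.sum_range_add, two_mul]
    refine add_le_add le_rfl ?_
    calc ∑ j ∈ Finset.range m, (q ^ (d + j + 1)) ^ 2
        ≤ ∑ j ∈ Finset.range m, (q ^ (j + 1)) ^ 2 := by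
          refine Finset.sum_le_sum fun j _ => ?_
          exact pow_le_pow_left₀ (by positivity)
            (pow_le_pow_of_le_one h0.le h1.le (by omega)) 2
      _ ≤ ∑ j ∈ Finset.range d, (q ^ (j + 1)) ^ 2 :=
          Finset.sum_le_sum_of_subset_of_nonneg (Finset.range_subset_range.2 (by omega))
            fun _ _ _ => sq_nonneg _
  rw [e1, mul_pow, div_pow]
  have hqm : 0 ≤ (q ^ m) ^ 2 := sq_nonneg _
  nlinarith [mul_le_mul_of_nonneg_left e2 hqm, mul_nonneg hqm (hs d)]

lemma le_norm_geom (hn : 0 < n) : q ≤ ‖trunc n fun i => q ^ (i + 1)‖ := by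
  refine le_of_sq_le_sq ?_ (norm_nonneg _)
  rw [norm_sq_eq_sum_co]
  refine le_trans ?_ (Finset.single_le_sum (fun _ _ => sq_nonneg _) (Finset.mem_range.2 hn))
  rw [co_trunc _ hn]; simp

/-- Vectors supported on few coordinates stay away from the saddle point. -/
lemma saddle_tail_lower_bound (hθ : θ.Admissible) (hq : IsRate θ q) (h0 : 0 < q) (h1 : q < 1)
    (M : ℕ) : ∃ N : ℕ, ∀ n, N ≤ n → ∀ xs : E n, opG θ n xs = bHat θ q n →
      q / 2 ≤ ‖xs‖ ∧ ∀ m ≤ M, ∀ z : E n, (∀ j, m ≤ j → co z j = 0) →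
        q ^ (2 * m) / 16 * ‖xs‖ ^ 2 ≤ ‖z - xs‖ ^ 2 := by
  have hlim : Filter.Tendsto (fun n : ℕ => (5 + θ.α) / θ.β * q ^ n) Filter.atTop (nhds 0) := by
    simpa using (tendsto_pow_atTop_nhds_zero_of_lt_one h0.le h1).const_mul ((5 + θ.α) / θ.β)
  have hpos : 0 < q ^ (M + 1) / 8 := by positivity
  obtain ⟨N, hN⟩ := Filter.eventually_atTop.1 (hlim.eventually_lt_const hpos)
  refine ⟨N + 2 * M + 1, fun n hn xs hxs => ?_⟩
  have hδ := (norm_sub_geom_le hθ hq h0 h1 (by omega) hxs).trans (hN n (by omega)).le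
  have ht := le_norm_geom (n := n) (q := q) (by omega)
  set xh := trunc n fun i => q ^ (i + 1) with hxh
  have t1 : ‖xs‖ ≤ ‖xh‖ + ‖xs - xh‖ := by
    simpa using norm_add_le xh (xs - xh)
  have t2 : ‖xh‖ ≤ ‖xs‖ + ‖xs - xh‖ := by
    have := norm_sub_le xs (xs - xh)
    rwa [sub_sub_cancel] at this
  refine ⟨?_, fun m hm z hz => ?_⟩
  · have : q ^ (M + 1) ≤ q := by
      simpa using pow_le_pow_of_le_one h0.le h1.le (Nat.le_add_left 1 M)
    linarith
  · have g := geom_tail_lower_bound (n := n) h0 h1 (m := m) (by omega) hz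
    rw [← hxh] at g
    have t3 : ‖z - xh‖ ≤ ‖z - xs‖ + ‖xs - xh‖ := norm_sub_le_norm_sub_add_norm_sub _ _ _
    have hqm : 0 < q ^ m := pow_pos h0 m
    have hqm1 : q ^ m ≤ 1 := pow_le_one₀ h0.le h1.le
    have hM : q ^ (M + 1) ≤ q ^ m * q := by
      rw [← pow_succ]; exact pow_le_pow_of_le_one h0.le h1.le (by omega)
    have key : q ^ m / 4 * ‖xs‖ ≤ ‖z - xs‖ := by
      have a1 : q ^ m * q ≤ q ^ m * ‖xh‖ := mul_le_mul_of_nonneg_left ht hqm.le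
      have a2 : q ^ m * ‖xs‖ ≤ q ^ m * (‖xh‖ + ‖xs - xh‖) := mul_le_mul_of_nonneg_left t1 hqm.le
      have a3 : q ^ m * ‖xs - xh‖ ≤ ‖xs - xh‖ := mul_le_of_le_one_left (norm_nonneg _) hqm1
      nlinarith
    have := pow_le_pow_left₀ (by positivity) key 2
    calc q ^ (2 * m) / 16 * ‖xs‖ ^ 2 = (q ^ m / 4 * ‖xs‖) ^ 2 := by ring
      _ ≤ _ := this

end Decay

section Rotation

variable {n : ℕ}

lemma exists_householder {W W' : Submodule ℝ (E n)} (hW : W < W') (z : E n) :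
    ∃ R : Matrix (Fin n) (Fin n) ℝ, R.transpose = R ∧ R * R = 1 ∧ (∀ w ∈ W, act R w = w) ∧
      act R z ∈ W' := by
  obtain ⟨p, hp, r, hr, hz⟩ := W.exists_add_mem_mem_orthogonal z
  obtain ⟨w', hw', hnot⟩ := SetLike.exists_of_lt hW
  obtain ⟨p', hp', r', hr', hw'z⟩ := W.exists_add_mem_mem_orthogonal w'
  have hr'W : r' ∈ W' := by
    have : r' = w' - p' := by rw [hw'z]; abel
    rw [this]
    exact W'.sub_mem hw' (hW.le hp')
  have hr0 : r' ≠ 0 := by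
    rintro rfl
    exact hnot (by rw [hw'z, add_zero]; exact hp')
  set u : E n := (‖r‖ / ‖r'‖) • r' with hu
  have hnorm : ‖r‖ = ‖u‖ := by
    rw [hu, norm_smul, Real.norm_of_nonneg (by positivity),
      div_mul_cancel₀ _ (norm_ne_zero_iff.2 hr0)]
  let K : Submodule ℝ (E n) := (Submodule.span ℝ {r - u})ᗮ
  let R : Matrix (Fin n) (Fin n) ℝ := Matrix.toEuclideanLin.symm (K.reflection : E n →ₗ[ℝ] E n)
  have hR : ∀ x, act R x = K.reflection x := fun x => by
    simp only [act, R, LinearEquiv.apply_symm_apply]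
    rfl
  have hfix : ∀ w ∈ W, K.reflection w = w := by
    intro w hw
    refine Submodule.reflection_mem_subspace_eq_self ?_
    rw [Submodule.mem_orthogonal_singleton_iff_inner_left]
    exact (W.mem_orthogonal (r - u)).1 (Submodule.sub_mem _ hr (Submodule.smul_mem _ _ hr')) w hw
  have hext : ∀ M N : Matrix (Fin n) (Fin n) ℝ, (∀ x, act M x = act N x) → M = N := fun M N h =>
    Matrix.toEuclideanLin.injective (LinearMap.ext h)
  refine ⟨R, hext _ _ fun x => ?_, hext _ _ fun x => ?_, fun w hw => by rw [hR, hfix w hw], ?_⟩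
  · refine ext_inner_left ℝ fun y => ?_
    rw [← inner_act_left, hR, hR]
    have := K.reflection.inner_map_map (K.reflection y) x
    rwa [Submodule.reflection_reflection, eq_comm] at this
  · rw [act_mul, hR, hR, Submodule.reflection_reflection, act_one]
  · rw [hR, hz, map_add, hfix p hp, Submodule.reflection_sub hnorm]
    exact W'.add_mem (hW.le hp) (W'.smul_mem _ hr'W)

/-- An orthogonal matrix can be modified, without changing its transpose on `W`, so that a given
vector enters the rotated copy of a larger space `W'`. -/
lemma exists_rotation {W W' : Submodule ℝ (E n)} {U : Matrix (Fin n) (Fin n) ℝ}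
    (hU : U ∈ Matrix.orthogonalGroup (Fin n) ℝ) (hW : W < W') (z : E n) :
    ∃ U' ∈ Matrix.orthogonalGroup (Fin n) ℝ,
      (∀ w ∈ W, act U'.transpose w = act U.transpose w) ∧ z ∈ W'.map (act U'.transpose) := by
  have hlt : W.map (act U.transpose) < W'.map (act U.transpose) := by
    refine Submodule.map_strictMono_of_injective (fun x y h => ?_) hW
    rw [← act_act_transpose hU x, h, act_act_transpose hU y]
  obtain ⟨R, hRt, hRR, hfix, hmem⟩ := exists_householder hlt z
  refine ⟨U * R, mul_mem hU ?_, fun w hw => ?_, ?_⟩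
  · rw [Matrix.mem_orthogonalGroup_iff, ← hRR]
    exact congrArg (R * ·) hRt
  · rw [Matrix.transpose_mul, act_mul, hRt, hfix _ (Submodule.mem_map_of_mem hw)]
  · obtain ⟨w, hw, hwz⟩ := hmem
    refine ⟨w, hw, ?_⟩
    rw [Matrix.transpose_mul, act_mul, hRt, hwz, ← act_mul, hRR, act_one]

end Rotation

section Krylov

variable {n : ℕ} {θ : Params} {q : ℝ}

lemma Hx_mono {m m' : ℕ} (h : m ≤ m') : Hx θ q n m ≤ Hx θ q n m' :=
  Submodule.span_mono fun _ ⟨i, hi, hv⟩ => ⟨i, hi.trans h, hv⟩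

lemma Hy_mono {m m' : ℕ} (h : m ≤ m') : Hy θ q n m ≤ Hy θ q n m' :=
  Submodule.span_mono fun _ ⟨i, hi, hv⟩ => ⟨i, hi.trans h, hv⟩

lemma matA_mem_Hx {m : ℕ} {v : E n} (hv : v ∈ Hy θ q n m) :
    act (matA n) v ∈ Hx θ q n (m + 1) := by
  refine Submodule.span_le (p := (Hx θ q n (m + 1)).comap (act (matA n))) |>.2 ?_ hv
  rintro _ ⟨i, hi, rfl⟩
  exact Submodule.subset_span ⟨i, by omega, act_matA_pow_comm _ _⟩

lemma matA_mem_Hy {m : ℕ} {v : E n} (hv : v ∈ Hx θ q n m) :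
    act (matA n) v ∈ Hy θ q n m := by
  refine Submodule.span_le (p := (Hy θ q n m).comap (act (matA n))) |>.2 ?_ hv
  rintro _ ⟨i, hi, rfl⟩
  refine Submodule.subset_span ⟨i + 1, by omega, ?_⟩
  simp only [act_matA_pow_two_mul, act_matA_pow_comm]

lemma gx_mem {m : ℕ} {u v : E n} (hu : u ∈ Hx θ q n m) (hv : v ∈ Hy θ q n m) :
    gx θ u v ∈ Hx θ q n (m + 1) :=
  add_mem (add_mem (Submodule.smul_mem _ _ (matA_mem_Hx (matA_mem_Hy hu)))
    (Submodule.smul_mem _ _ (Hx_mono m.le_succ hu))) (Submodule.smul_mem _ _ (matA_mem_Hx hv))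

lemma gy_mem {m : ℕ} {u v : E n} (hu : u ∈ Hx θ q n m) (hv : v ∈ Hy θ q n m) :
    gy θ q u v ∈ Hy θ q n (m + 1) := by
  refine sub_mem (sub_mem (sub_mem (Submodule.smul_mem _ _ (Hy_mono m.le_succ (matA_mem_Hy hu)))
    (Submodule.smul_mem _ _ (matA_mem_Hy (matA_mem_Hx hv))))
    (Submodule.smul_mem _ _ (Hy_mono m.le_succ hv))) ?_
  exact Submodule.subset_span ⟨0, by omega, by rw [mul_zero, pow_zero, act_one]⟩

lemma co_matA_matA_eq_zero {x : E n} {m : ℕ} (hx : ∀ j, m ≤ j → co x j = 0) (hm : 0 < m) {j : ℕ}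
    (hj : m + 1 ≤ j) : co (act (matA n) (act (matA n) x)) j = 0 := by
  rcases lt_or_ge j n with h | h
  · obtain ⟨i, rfl⟩ : ∃ i, j = i + 1 := ⟨j - 1, by omega⟩
    rw [co_matA_matA_succ x h, hx _ (by omega), hx _ (by omega), hx _ (by omega)]
    ring
  · exact co_of_le _ h

lemma co_krylov (i : ℕ) :
    (∀ j, i + 2 ≤ j → co (act (matA n ^ (2 * i)) (bHat θ q n)) j = 0) ∧
      (i + 1 < n → co (act (matA n ^ (2 * i)) (bHat θ q n)) (i + 1) = (-1) ^ i * (q - 1)) := by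
  induction i with
  | zero =>
    rw [mul_zero, pow_zero, act_one]
    constructor
    · intro j hj
      rcases lt_or_ge j n with h | h
      · rw [co_of_lt _ h]
        simp only [bHat]
        rw [if_neg (by omega), if_neg (by omega)]
      · exact co_of_le _ h
    · intro h
      rw [co_of_lt _ h]
      simp [bHat]
  | succ i ih =>
    rw [act_matA_pow_two_mul]
    refine ⟨fun j hj => co_matA_matA_eq_zero ih.1 (by omega) (by omega), fun h => ?_⟩
    rw [co_matA_matA_succ _ h, ih.1 (i + 1 + 1) (by omega), ih.1 (i + 1 + 2) (by omega),
      ih.2 (by omega)]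
    ring

lemma co_eq_zero_of_mem_Hx {m : ℕ} {x : E n} (hx : x ∈ Hx θ q n m) {j : ℕ} (hj : m ≤ j) :
    co x j = 0 := by
  induction hx using Submodule.span_induction with
  | mem x h =>
    obtain ⟨i, hi, rfl⟩ := h
    rw [matA_vecB, map_smul, co_smul, (co_krylov i).1 j (by omega), mul_zero]
  | zero => exact co_zero j
  | add x y _ _ h1 h2 => rw [co_add, h1, h2, add_zero]
  | smul a x _ h => rw [co_smul, h, mul_zero]

lemma krylov_notMem_Hx (hθ : θ.Admissible) (hq : q ≠ 1) {i : ℕ} (hn : i + 1 < n) :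
    act (matA n ^ (2 * i)) (act (matA n) (vecB θ q n)) ∉ Hx θ q n (i + 1) := by
  intro h
  have h1 := co_eq_zero_of_mem_Hx h le_rfl
  rw [matA_vecB, map_smul, co_smul, (co_krylov i).2 hn] at h1
  have h2 := hθ.Bx_pos
  have h3 := hθ.By_pos
  have h4 := hθ.Lxy_pos
  have h5 : q - 1 ≠ 0 := sub_ne_zero.2 hq
  have : 2 * θ.Bx * θ.By / θ.Lxy * ((-1) ^ i * (q - 1)) ≠ 0 := by positivity
  exact this h1

lemma Hx_lt (hθ : θ.Admissible) (hq : q ≠ 1) {m : ℕ} (hm : 1 ≤ m) (hn : m < n) :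
    Hx θ q n m < Hx θ q n (m + 1) := by
  refine lt_of_le_of_ne (Hx_mono m.le_succ) fun h => ?_
  obtain ⟨i, rfl⟩ : ∃ i, m = i + 1 := ⟨m - 1, by omega⟩
  refine krylov_notMem_Hx hθ hq hn ?_
  rw [h]
  exact Submodule.subset_span ⟨i, le_rfl, rfl⟩

lemma Hy_lt (hθ : θ.Admissible) (hq : q ≠ 1) {m : ℕ} (hn : m + 1 < n) :
    Hy θ q n m < Hy θ q n (m + 1) := by
  refine lt_of_le_of_ne (Hy_mono m.le_succ) fun h => krylov_notMem_Hx hθ hq hn ?_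
  rw [← act_matA_pow_comm]
  refine matA_mem_Hx ?_
  rw [h]
  exact Submodule.subset_span ⟨m, le_rfl, rfl⟩

end Krylov

section Run

variable {n : ℕ} {θ : Params} {q : ℝ} {𝒜 : PureAlgorithm (E n) (E n)}
  {U V U' V' : Matrix (Fin n) (Fin n) ℝ}

lemma runRot_zero : runRot 𝒜 θ q U V 0 = ⟨0, 0, 0, 0⟩ := by
  rw [runRot, PureAlgorithm.run]

lemma runRot_succ (k : ℕ) : runRot 𝒜 θ q U V (k + 1) =
    ⟨(𝒜.stepX k θ fun i => ((runRot 𝒜 θ q U V i).x,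
        gradX (rotF θ q n U V) (runRot 𝒜 θ q U V i).x (runRot 𝒜 θ q U V i).y)).1,
      (𝒜.stepY k θ fun i => ((runRot 𝒜 θ q U V i).y,
        gradY (rotF θ q n U V) (runRot 𝒜 θ q U V i).x (runRot 𝒜 θ q U V i).y)).1,
      (𝒜.stepX k θ fun i => ((runRot 𝒜 θ q U V i).x,
        gradX (rotF θ q n U V) (runRot 𝒜 θ q U V i).x (runRot 𝒜 θ q U V i).y)).2,
      (𝒜.stepY k θ fun i => ((runRot 𝒜 θ q U V i).y,
        gradY (rotF θ q n U V) (runRot 𝒜 θ q U V i).x (runRot 𝒜 θ q U V i).y)).2⟩ := by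
  unfold runRot
  rw [PureAlgorithm.run]

/-- The transposes of `U'` and `V'` act on the Krylov spaces of index `m` as those of `U`, `V`. -/
def Agree (θ : Params) (q : ℝ) (m : ℕ) (U V U' V' : Matrix (Fin n) (Fin n) ℝ) : Prop :=
  (∀ w ∈ Hx θ q n m, act U'.transpose w = act U.transpose w) ∧
    ∀ w ∈ Hy θ q n m, act V'.transpose w = act V.transpose w

/-- The pair `(x, y)` lies in the rotated Krylov spaces of index `m`. -/
def InKrylov (θ : Params) (q : ℝ) (m : ℕ) (U V : Matrix (Fin n) (Fin n) ℝ) (x y : E n) : Prop :=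
  x ∈ (Hx θ q n m).map (act U.transpose) ∧ y ∈ (Hy θ q n m).map (act V.transpose)

lemma InKrylov.mono {m m' : ℕ} {x y : E n} (h : InKrylov θ q m U V x y) (hm : m ≤ m') :
    InKrylov θ q m' U V x y :=
  ⟨Submodule.map_mono (Hx_mono hm) h.1, Submodule.map_mono (Hy_mono hm) h.2⟩

lemma InKrylov.zero (m : ℕ) : InKrylov θ q m U V 0 0 := ⟨zero_mem _, zero_mem _⟩

lemma Agree.mono {m m' : ℕ} (h : Agree θ q m' U V U' V') (hm : m ≤ m') : Agree θ q m U V U' V' :=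
  ⟨fun w hw => h.1 w (Hx_mono hm hw), fun w hw => h.2 w (Hy_mono hm hw)⟩

lemma InKrylov.congr {m : ℕ} {x y : E n} (h : InKrylov θ q m U V x y)
    (ha : Agree θ q m U V U' V') : InKrylov θ q m U' V' x y := by
  obtain ⟨⟨u, hu, rfl⟩, v, hv, rfl⟩ := h
  exact ⟨⟨u, hu, ha.1 u hu⟩, v, hv, ha.2 v hv⟩

lemma grad_congr (hθ : θ.Admissible) (hU : U ∈ Matrix.orthogonalGroup (Fin n) ℝ)
    (hV : V ∈ Matrix.orthogonalGroup (Fin n) ℝ) (hU' : U' ∈ Matrix.orthogonalGroup (Fin n) ℝ)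
    (hV' : V' ∈ Matrix.orthogonalGroup (Fin n) ℝ) {m : ℕ} {x y : E n}
    (h : InKrylov θ q m U V x y) (ha : Agree θ q (m + 1) U V U' V') :
    gradX (rotF θ q n U' V') x y = gradX (rotF θ q n U V) x y ∧
      gradY (rotF θ q n U' V') x y = gradY (rotF θ q n U V) x y := by
  obtain ⟨⟨u, hu, rfl⟩, v, hv, rfl⟩ := h
  rw [gradX_rotF hθ q hU, gradX_rotF hθ q hU', gradY_rotF hθ q hV, gradY_rotF hθ q hV']
  rw [act_act_transpose hU, act_act_transpose hV, ← ha.1 u (Hx_mono m.le_succ hu),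
    ← ha.2 v (Hy_mono m.le_succ hv), act_act_transpose hU', act_act_transpose hV']
  exact ⟨ha.1 _ (gx_mem hu hv), ha.2 _ (gy_mem hu hv)⟩

lemma runRot_congr (hθ : θ.Admissible) (hU : U ∈ Matrix.orthogonalGroup (Fin n) ℝ)
    (hV : V ∈ Matrix.orthogonalGroup (Fin n) ℝ) (hU' : U' ∈ Matrix.orthogonalGroup (Fin n) ℝ)
    (hV' : V' ∈ Matrix.orthogonalGroup (Fin n) ℝ) {m k : ℕ}
    (h : ∀ i < k, InKrylov θ q m U V (runRot 𝒜 θ q U V i).x (runRot 𝒜 θ q U V i).y)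
    (ha : Agree θ q (m + 1) U V U' V') :
    ∀ i ≤ k, runRot 𝒜 θ q U' V' i = runRot 𝒜 θ q U V i := by
  intro i
  induction i using Nat.strong_induction_on with
  | _ i ih =>
    intro hi
    rcases i with _ | i
    · rw [runRot_zero, runRot_zero]
    · have e : ∀ j : Fin (i + 1), runRot 𝒜 θ q U' V' j = runRot 𝒜 θ q U V j := fun j =>
        ih j j.2 (by omega)
      have g := fun j : Fin (i + 1) =>
        grad_congr hθ hU hV hU' hV' (h j (by omega)) ha
      rw [runRot_succ, runRot_succ]
      simp only [e, (g _).1, (g _).2]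

lemma exists_rotation_pair (hθ : θ.Admissible) (hq : q ≠ 1)
    (hU : U ∈ Matrix.orthogonalGroup (Fin n) ℝ) (hV : V ∈ Matrix.orthogonalGroup (Fin n) ℝ)
    {m : ℕ} (hm : 1 ≤ m) (hn : m + 1 < n) (x y : E n) :
    ∃ U' ∈ Matrix.orthogonalGroup (Fin n) ℝ, ∃ V' ∈ Matrix.orthogonalGroup (Fin n) ℝ,
      Agree θ q m U V U' V' ∧ InKrylov θ q (m + 1) U' V' x y := by
  obtain ⟨U', hU', h1, h2⟩ := exists_rotation hU (Hx_lt hθ hq hm (by omega)) x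
  obtain ⟨V', hV', h3, h4⟩ := exists_rotation hV (Hy_lt hθ hq hn) y
  exact ⟨U', hU', V', hV', ⟨h1, h3⟩, h2, h4⟩

lemma exists_rotation_iterates (hθ : θ.Admissible) (hq : q ≠ 1) (𝒜 : PureAlgorithm (E n) (E n))
    (k : ℕ) (hn : 2 * k < n) :
    ∃ U ∈ Matrix.orthogonalGroup (Fin n) ℝ, ∃ V ∈ Matrix.orthogonalGroup (Fin n) ℝ,
      ∀ i ≤ k, InKrylov θ q (2 * k) U V (runRot 𝒜 θ q U V i).x (runRot 𝒜 θ q U V i).y := by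
  induction k with
  | zero =>
    refine ⟨1, one_mem _, 1, one_mem _, fun i hi => ?_⟩
    obtain rfl : i = 0 := by omega
    rw [runRot_zero]
    exact InKrylov.zero _
  | succ k ih =>
    obtain ⟨U, hU, V, hV, h⟩ := ih (by omega)
    obtain ⟨U', hU', V', hV', ha, hk⟩ := exists_rotation_pair (m := 2 * k + 1) hθ hq hU hV
      (by omega) (by omega) (runRot 𝒜 θ q U V (k + 1)).x (runRot 𝒜 θ q U V (k + 1)).y
    refine ⟨U', hU', V', hV', fun i hi => ?_⟩
    rw [runRot_congr hθ hU hV hU' hV' (k := k + 1) (fun i hi => h i (by omega)) ha i hi]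
    rcases hi.eq_or_lt with rfl | hi
    · exact hk
    · exact ((h i (by omega)).congr (ha.mono (by omega))).mono (by omega)

lemma exists_rotation_final_output (hθ : θ.Admissible) (hq : q ≠ 1)
    (𝒜 : PureAlgorithm (E n) (E n)) (k : ℕ) (hn : 2 * k + 1 < n) :
    ∃ U ∈ Matrix.orthogonalGroup (Fin n) ℝ, ∃ V ∈ Matrix.orthogonalGroup (Fin n) ℝ,
      (∀ i ≤ k, InKrylov θ q (2 * k) U V (runRot 𝒜 θ q U V i).x (runRot 𝒜 θ q U V i).y) ∧
        InKrylov θ q (2 * k + 1) U V (runRot 𝒜 θ q U V k).outX (runRot 𝒜 θ q U V k).outY := by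
  rcases k with _ | k
  · obtain ⟨U, hU, V, hV, h⟩ := exists_rotation_iterates hθ hq 𝒜 0 (by omega)
    refine ⟨U, hU, V, hV, h, ?_⟩
    rw [runRot_zero]
    exact InKrylov.zero _
  · -- the last gradients available to the output are those of the first `k + 1` iterates
    obtain ⟨U₀, hU₀, V₀, hV₀, h₀⟩ := exists_rotation_iterates hθ hq 𝒜 k (by omega)
    obtain ⟨U₁, hU₁, V₁, hV₁, a₁, k₁⟩ := exists_rotation_pair (m := 2 * k + 1) hθ hq hU₀ hV₀
      (by omega) (by omega) (runRot 𝒜 θ q U₀ V₀ (k + 1)).x (runRot 𝒜 θ q U₀ V₀ (k + 1)).y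
    obtain ⟨U₂, hU₂, V₂, hV₂, a₂, k₂⟩ := exists_rotation_pair (m := 2 * k + 2) hθ hq hU₁ hV₁
      (by omega) (by omega) (runRot 𝒜 θ q U₀ V₀ (k + 1)).outX (runRot 𝒜 θ q U₀ V₀ (k + 1)).outY
    have a : Agree θ q (2 * k + 1) U₀ V₀ U₂ V₂ :=
      ⟨fun w hw => (a₂.1 w (Hx_mono (by omega) hw)).trans (a₁.1 w hw),
        fun w hw => (a₂.2 w (Hy_mono (by omega) hw)).trans (a₁.2 w hw)⟩
    have e := runRot_congr (𝒜 := 𝒜) hθ hU₀ hV₀ hU₂ hV₂ (k := k + 1)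
      (fun i hi => h₀ i (by omega)) a
    refine ⟨U₂, hU₂, V₂, hV₂, fun i hi => ?_, ?_⟩
    · rw [e i hi]
      rcases hi.eq_or_lt with rfl | hi
      · exact k₁.congr a₂
      · exact ((h₀ i (by omega)).congr (a.mono (by omega))).mono (by omega)
    · rw [e _ le_rfl]
      exact k₂

lemma exists_rotation_all_outputs (hθ : θ.Admissible) (hq : q ≠ 1)
    (𝒜 : PureAlgorithm (E n) (E n)) (k : ℕ) (hn : 3 * k < n) :
    ∃ U ∈ Matrix.orthogonalGroup (Fin n) ℝ, ∃ V ∈ Matrix.orthogonalGroup (Fin n) ℝ,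
      ∀ i ≤ k, InKrylov θ q (3 * i) U V (runRot 𝒜 θ q U V i).x (runRot 𝒜 θ q U V i).y ∧
        InKrylov θ q (3 * i) U V (runRot 𝒜 θ q U V i).outX (runRot 𝒜 θ q U V i).outY := by
  induction k with
  | zero =>
    refine ⟨1, one_mem _, 1, one_mem _, fun i hi => ?_⟩
    obtain rfl : i = 0 := by omega
    rw [runRot_zero]
    exact ⟨InKrylov.zero _, InKrylov.zero _⟩
  | succ k ih =>
    obtain ⟨U₀, hU₀, V₀, hV₀, h₀⟩ := ih (by omega)
    obtain ⟨U₁, hU₁, V₁, hV₁, a₁, k₁⟩ := exists_rotation_pair (m := 3 * k + 1) hθ hq hU₀ hV₀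
      (by omega) (by omega) (runRot 𝒜 θ q U₀ V₀ (k + 1)).x (runRot 𝒜 θ q U₀ V₀ (k + 1)).y
    obtain ⟨U₂, hU₂, V₂, hV₂, a₂, k₂⟩ := exists_rotation_pair (m := 3 * k + 2) hθ hq hU₁ hV₁
      (by omega) (by omega) (runRot 𝒜 θ q U₀ V₀ (k + 1)).outX (runRot 𝒜 θ q U₀ V₀ (k + 1)).outY
    have a : Agree θ q (3 * k + 1) U₀ V₀ U₂ V₂ :=
      ⟨fun w hw => (a₂.1 w (Hx_mono (by omega) hw)).trans (a₁.1 w hw),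
        fun w hw => (a₂.2 w (Hy_mono (by omega) hw)).trans (a₁.2 w hw)⟩
    have e := runRot_congr (𝒜 := 𝒜) hθ hU₀ hV₀ hU₂ hV₂ (k := k + 1)
      (fun i hi => (h₀ i (by omega)).1.mono (by omega)) a
    refine ⟨U₂, hU₂, V₂, hV₂, fun i hi => ?_⟩
    rw [e i hi]
    rcases hi.eq_or_lt with rfl | hi
    · exact ⟨(k₁.congr a₂).mono (by omega), k₂⟩
    · exact ⟨(h₀ i (by omega)).1.congr (a.mono (by omega)),
        (h₀ i (by omega)).2.congr (a.mono (by omega))⟩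

end Run

section Rate

variable {θ : Params} {q : ℝ}

lemma Params.Admissible.two_lt_cond (hθ : θ.Admissible) : 2 < θ.cond := by
  have h1 := hθ.μx_pos
  have h2 := hθ.μy_pos
  have h3 := hθ.Lxy_pos
  have h4 : 1 < θ.Lx / θ.μx := (one_lt_div h1).2 hθ.μx_lt
  have h5 : 1 < θ.Ly / θ.μy := (one_lt_div h2).2 hθ.μy_lt
  have h6 : 0 < θ.Lxy ^ 2 / (θ.μx * θ.μy) := by positivity
  unfold Params.cond
  linarith

lemma Params.Admissible.four_mul_α (hθ : θ.Admissible) : 4 * θ.α = (θ.cond - 2) * θ.β := by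
  have h1 := hθ.μx_pos.ne'
  have h2 := hθ.μy_pos.ne'
  have hx : θ.Lx = 4 * θ.Bx + θ.μx := by unfold Params.Bx; ring
  have hy : θ.Ly = 4 * θ.By + θ.μy := by unfold Params.By; ring
  have h4 := hθ.Bx_pos.ne'
  have h5 := hθ.By_pos.ne'
  unfold Params.cond Params.α Params.β
  rw [hx, hy]
  field_simp
  ring

lemma Params.Admissible.four_mul_β_lt (hθ : θ.Admissible) : 4 * θ.β < θ.α ^ 2 := by
  have h1 := hθ.μx_pos
  have h2 := hθ.μy_pos
  have h3 := hθ.Lxy_pos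
  have h4 := hθ.Bx_pos
  have h5 := hθ.By_pos
  have e : θ.β = θ.μx / θ.Bx * (θ.μy / θ.By) := by
    unfold Params.β; field_simp
  have p1 : 0 < θ.μx / θ.Bx := by positivity
  have p2 : 0 < θ.μy / θ.By := by positivity
  have p3 : 0 < θ.Lxy ^ 2 / (4 * θ.Bx * θ.By) := by positivity
  rw [e, Params.α]
  nlinarith [sq_nonneg (θ.μx / θ.Bx - θ.μy / θ.By), mul_pos p3 p1, mul_pos p3 p2, mul_pos p3 p3]

/-- The half-square-root form of the lower end of the rate interval. -/
lemma half_sqrt_cond (θ : Params) : 1 / (2 * √2) * √θ.cond = √(θ.cond / 2) / 2 := by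
  rw [Real.sqrt_div' _ zero_le_two]
  field_simp

lemma exists_isRate (hθ : θ.Admissible) : ∃ q, IsRate θ q := by
  have hα := hθ.α_pos
  have hβ := hθ.β_pos
  have hS := hθ.two_lt_cond
  have hαβ := hθ.four_mul_α
  have hdisc := hθ.four_mul_β_lt
  set D := √(θ.α ^ 2 - 4 * θ.β) with hD
  have hDsq : D ^ 2 = θ.α ^ 2 - 4 * θ.β := Real.sq_sqrt (by linarith)
  have hD0 : 0 < D := Real.sqrt_pos.2 (by linarith)
  have hDα : D < θ.α := by nlinarith
  set z := (θ.α + D) / (2 * θ.β) with hz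
  have hzβ : z * (2 * θ.β) = θ.α + D := by rw [hz]; field_simp
  have hroot : θ.β * z ^ 2 - θ.α * z + 1 = 0 := by
    have h : 4 * θ.β * (θ.β * z ^ 2 - θ.α * z + 1) = 0 := by
      linear_combination (z * (2 * θ.β) + θ.α + D - 2 * θ.α) * hzβ + hDsq
    exact (mul_eq_zero.1 h).resolve_left (by positivity)
  have hz0 : 0 < z := by positivity
  have hz1 : (θ.cond - 2) / 8 < z := by
    refine lt_of_mul_lt_mul_right ?_ (by positivity : 0 ≤ 2 * θ.β)
    rw [hzβ]; nlinarith
  have hz2 : z < (θ.cond - 2) / 4 := by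
    refine lt_of_mul_lt_mul_right ?_ (by positivity : 0 ≤ 2 * θ.β)
    rw [hzβ]; nlinarith
  set r := √(z + 1 / 4) with hr
  have hrsq : r ^ 2 = z + 1 / 4 := Real.sq_sqrt (by linarith)
  have hr0 : 0 ≤ r := Real.sqrt_nonneg _
  refine ⟨1 - (1 / 2 + r)⁻¹, ?_, ?_, ?_⟩
  · set t := (1 / 2 + r)⁻¹ with ht
    have htr : t * (1 / 2 + r) = 1 := inv_mul_cancel₀ (by positivity)
    have h1 : t ^ 2 * z = 1 - t := by
      linear_combination (-t ^ 2) * hrsq + (t * (1 / 2 + r) + 1 - t) * htr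
    have h2 : 1 - (4 + θ.α) * (1 - t) + (6 + 2 * θ.α + θ.β) * (1 - t) ^ 2
        - (4 + θ.α) * (1 - t) ^ 3 + (1 - t) ^ 4
        = t ^ 4 - θ.α * (1 - t) * t ^ 2 + θ.β * (1 - t) ^ 2 := by ring
    rw [h2, ← h1]
    linear_combination t ^ 4 * hroot
  · have h : √(θ.cond / 2) / 2 < r := by
      rw [hr, div_lt_iff₀ two_pos]
      refine (Real.sqrt_lt' (by positivity)).2 ?_
      rw [mul_pow, ← hr, hrsq]
      linarith
    rw [half_sqrt_cond]
    have : 0 ≤ √(θ.cond / 2) := Real.sqrt_nonneg _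
    have := inv_strictAnti₀ (by positivity : 0 < 1 / 2 + √(θ.cond / 2) / 2)
      (by linarith : 1 / 2 + √(θ.cond / 2) / 2 < 1 / 2 + r)
    linarith
  · have h : r < 1 / 2 * √(θ.cond - 1) := by
      have h2 : √(θ.cond - 1) ^ 2 = θ.cond - 1 := Real.sq_sqrt (by linarith)
      refine lt_of_pow_lt_pow_left₀ 2 (by positivity) ?_
      rw [mul_pow, h2, hrsq]
      linarith
    have := inv_strictAnti₀ (by positivity : 0 < 1 / 2 + r)
      (by linarith : 1 / 2 + r < 1 / 2 + 1 / 2 * √(θ.cond - 1))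
    linarith

lemma one_lt_sqrt_half_cond (hθ : θ.Admissible) : 1 < √(θ.cond / 2) := by
  have := hθ.two_lt_cond
  rw [Real.lt_sqrt zero_le_one]
  linarith

lemma IsRate.lower_bound (hq : IsRate θ q) :
    (√(θ.cond / 2) - 1) / (√(θ.cond / 2) + 1) < q := by
  have h := hq.lower
  rw [half_sqrt_cond] at h
  have h0 : 0 ≤ √(θ.cond / 2) := Real.sqrt_nonneg _
  convert h using 1
  field_simp
  ring

lemma IsRate.pos (hq : IsRate θ q) (hθ : θ.Admissible) : 0 < q := by
  have := one_lt_sqrt_half_cond hθ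
  exact lt_trans (div_pos (by linarith) (by linarith)) hq.lower_bound

lemma IsRate.lt_one (hq : IsRate θ q) : q < 1 :=
  hq.upper.trans (sub_lt_self _ (by positivity))

lemma exists_log_rate_bound {κ : ℝ} (hκ : 2 < κ) : ∃ c : ℝ, 0 < c ∧
    ∀ θ : Params, θ.Admissible → κ ≤ θ.cond → ∀ q, IsRate θ q →
      c * √θ.cond * Real.log (1 / q) ≤ 1 := by
  have hd : 0 < 1 - √(2 / κ) := by
    rw [sub_pos, Real.sqrt_lt' one_pos, div_lt_iff₀ (by linarith)]
    linarith
  refine ⟨(1 - √(2 / κ)) / (2 * √2), by positivity, fun θ hθ hS q hq => ?_⟩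
  have hR := one_lt_sqrt_half_cond hθ
  have hlow := hq.lower_bound
  have hq0 := hq.pos hθ
  have hRS : √θ.cond = √2 * √(θ.cond / 2) := by
    rw [← Real.sqrt_mul zero_le_two]
    congr 1
    ring
  have h1 : 1 ≤ √(2 / κ) * √(θ.cond / 2) := by
    rw [← Real.sqrt_mul (by positivity), Real.one_le_sqrt, div_mul_div_comm,
      le_div_iff₀ (by linarith)]
    linarith
  rw [hRS]
  set R := √(θ.cond / 2)
  have h2 : Real.log (1 / q) ≤ 1 / q - 1 := Real.log_le_sub_one_of_pos (by positivity)
  have h3 : (1 / q - 1) * (R - 1) ≤ 2 := by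
    rw [div_lt_iff₀ (by linarith)] at hlow
    have : (1 / q - 1) * (R - 1) = (1 - q) * (R - 1) / q := by field_simp
    rw [this, div_le_iff₀ hq0]
    linarith
  have h4 : 0 ≤ 1 / q - 1 := by
    rw [sub_nonneg, le_div_iff₀ hq0]
    linarith [hq.lt_one]
  calc (1 - √(2 / κ)) / (2 * √2) * (√2 * R) * Real.log (1 / q)
      = (1 - √(2 / κ)) * R / 2 * Real.log (1 / q) := by field_simp
    _ ≤ (1 - √(2 / κ)) * R / 2 * (1 / q - 1) :=
        mul_le_mul_of_nonneg_left h2 (by positivity)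
    _ ≤ (R - 1) / 2 * (1 / q - 1) :=
        mul_le_mul_of_nonneg_right (by linarith) h4
    _ ≤ 1 := by linarith

end Rate

section LowerBound

variable {θ : Params} {q : ℝ}

lemma norm_output_sub_lower_bound {n m : ℕ} {a : ℝ} {xs z : E n}
    {U : Matrix (Fin n) (Fin n) ℝ} (hU : U ∈ Matrix.orthogonalGroup (Fin n) ℝ)
    (hz : z ∈ (Hx θ q n m).map (act U.transpose))
    (h : ∀ w : E n, (∀ j, m ≤ j → co w j = 0) → a ≤ ‖w - xs‖ ^ 2) :
    a ≤ ‖z - act U.transpose xs‖ ^ 2 := by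
  obtain ⟨w, hw, rfl⟩ := hz
  rw [← map_sub, norm_act_transpose hU]
  exact h w fun j hj => co_eq_zero_of_mem_Hx hw hj

theorem iteration_lower_bound (hθ : θ.Admissible) (hq : IsRate θ q) (k : ℕ) :
    ∃ N : ℕ, ∀ n : ℕ, N ≤ n → ∃ xs ys : E n, IsSaddlePoint (worstF θ q n) xs ys ∧
      (∀ x y : E n, IsSaddlePoint (worstF θ q n) x y → x = xs ∧ y = ys) ∧
      ∀ 𝒜 : PureAlgorithm (E n) (E n),
        ∃ U ∈ Matrix.orthogonalGroup (Fin n) ℝ, ∃ V ∈ Matrix.orthogonalGroup (Fin n) ℝ,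
          InClass θ (rotF θ q n U V) ∧
          IsSaddlePoint (rotF θ q n U V) (act U.transpose xs) (act V.transpose ys) ∧
          (∀ i ≤ k, InKrylov θ q (2 * k) U V (runRot 𝒜 θ q U V i).x (runRot 𝒜 θ q U V i).y) ∧
          InKrylov θ q (2 * k + 1) U V (runRot 𝒜 θ q U V k).outX (runRot 𝒜 θ q U V k).outY ∧
          q ^ (4 * k + 2) / 16 * ‖xs‖ ^ 2 ≤
            ‖(runRot 𝒜 θ q U V k).outX - act U.transpose xs‖ ^ 2 := by
  obtain ⟨N, hN⟩ := saddle_tail_lower_bound hθ hq (hq.pos hθ) hq.lt_one (2 * k + 1)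
  refine ⟨N + 2 * k + 2, fun n hn => ?_⟩
  obtain ⟨xs, ys, hG, hx, hy⟩ := exists_stationary hθ q n
  have hs := isSaddlePoint_of_stationary hθ hx hy
  refine ⟨xs, ys, hs, fun x y h => eq_of_isSaddlePoint hθ hx hy h, fun 𝒜 => ?_⟩
  obtain ⟨U, hU, V, hV, hit, hout⟩ :=
    exists_rotation_final_output hθ hq.lt_one.ne 𝒜 k (by omega)
  refine ⟨U, hU, V, hV, inClass_rotF hθ q hU hV, isSaddlePoint_rotF hU hV hs, hit, hout, ?_⟩
  rw [show 4 * k + 2 = 2 * (2 * k + 1) by ring]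
  exact norm_output_sub_lower_bound hU hout.1 ((hN n (by omega) xs hG).2 (2 * k + 1) le_rfl)

theorem gap_lower_bound (hθ : θ.Admissible) (hq : IsRate θ q) (K : ℕ) :
    ∃ N : ℕ, ∀ n : ℕ, N ≤ n → ∀ 𝒜 : PureAlgorithm (E n) (E n),
      ∃ U ∈ Matrix.orthogonalGroup (Fin n) ℝ, ∃ V ∈ Matrix.orthogonalGroup (Fin n) ℝ,
        InClass θ (rotF θ q n U V) ∧ ∀ k ≤ K,
          ((q ^ (6 * k) * (θ.μx * q ^ 2 / 128) : ℝ) : EReal) ≤ dualityGap (rotF θ q n U V)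
            (runRot 𝒜 θ q U V k).outX (runRot 𝒜 θ q U V k).outY := by
  have hq0 := hq.pos hθ
  have hμ := hθ.μx_pos
  obtain ⟨N, hN⟩ := saddle_tail_lower_bound hθ hq hq0 hq.lt_one (3 * K)
  refine ⟨N + 3 * K + 1, fun n hn 𝒜 => ?_⟩
  obtain ⟨xs, ys, hG, hx, hy⟩ := exists_stationary hθ q n
  obtain ⟨U, hU, V, hV, h⟩ := exists_rotation_all_outputs hθ hq.lt_one.ne 𝒜 K (by omega)
  obtain ⟨hxs, htail⟩ := hN n (by omega) xs hG
  refine ⟨U, hU, V, hV, inClass_rotF hθ q hU hV, fun k hk => ?_⟩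
  refine le_trans ?_ (dualityGap_rotF_lower_bound hθ hU hV hx hy _ _)
  rw [EReal.coe_le_coe_iff]
  have h1 := norm_output_sub_lower_bound hU (h k hk).2.1 (htail (3 * k) (by omega))
  have h2 : (q / 2) ^ 2 ≤ ‖xs‖ ^ 2 := pow_le_pow_left₀ (by positivity) hxs 2
  calc q ^ (6 * k) * (θ.μx * q ^ 2 / 128)
      = θ.μx / 2 * (q ^ (2 * (3 * k)) / 16 * (q / 2) ^ 2) := by
        rw [show 6 * k = 2 * (3 * k) by ring]; ring
    _ ≤ θ.μx / 2 * (q ^ (2 * (3 * k)) / 16 * ‖xs‖ ^ 2) := by gcongr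
    _ ≤ _ := by gcongr

lemma log_le_of_pow_mul_le {a C ε : ℝ} (ha : 0 < a) (hC : 0 < C) (hε : 0 < ε)
    (hε' : ε ≤ (a / C) ^ 2) (hq : 0 < q) {k : ℕ} (h : q ^ (6 * k) * a ≤ C * ε) :
    Real.log (1 / ε) ≤ 12 * k * Real.log (1 / q) := by
  have hs : 0 < √ε := Real.sqrt_pos.2 hε
  have h1 : √ε ≤ a / C := Real.sqrt_le_iff.2 ⟨by positivity, hε'⟩
  have h2 : q ^ (6 * k) * (a / C) ≤ √ε * √ε := by
    rw [Real.mul_self_sqrt hε.le, ← mul_div_assoc, div_le_iff₀ hC]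
    linarith
  have h3 : q ^ (6 * k) ≤ √ε := by
    refine le_of_mul_le_mul_right (le_trans ?_ h2) hs
    gcongr
  have h4 := Real.log_le_log (by positivity) h3
  rw [Real.log_pow, Real.log_sqrt hε.le] at h4
  rw [one_div, one_div, Real.log_inv, Real.log_inv]
  push_cast at h4
  linarith

end LowerBound

end MinMax

end

theorem mainTheorem5 :
    (∀ θ : MinMax.Params, θ.Admissible →
      (∃ q : ℝ, MinMax.IsRate θ q) ∧
      ∀ q : ℝ, MinMax.IsRate θ q → ∀ k : ℕ, ∃ N : ℕ, ∀ n : ℕ, N ≤ n →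
        ∃ xs ys : MinMax.E n,
          MinMax.IsSaddlePoint (MinMax.worstF θ q n) xs ys ∧
          (∀ x y : MinMax.E n,
            MinMax.IsSaddlePoint (MinMax.worstF θ q n) x y → x = xs ∧ y = ys) ∧
          ∀ 𝒜 : MinMax.PureAlgorithm (MinMax.E n) (MinMax.E n),
            ∃ U ∈ Matrix.orthogonalGroup (Fin n) ℝ, ∃ V ∈ Matrix.orthogonalGroup (Fin n) ℝ,
              MinMax.InClass θ (MinMax.rotF θ q n U V) ∧
              MinMax.IsSaddlePoint (MinMax.rotF θ q n U V)
                (MinMax.act U.transpose xs) (MinMax.act V.transpose ys) ∧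
              (∀ i ≤ k,
                (MinMax.runRot 𝒜 θ q U V i).x ∈
                  (MinMax.Hx θ q n (2 * k)).map (MinMax.act U.transpose) ∧
                (MinMax.runRot 𝒜 θ q U V i).y ∈
                  (MinMax.Hy θ q n (2 * k)).map (MinMax.act V.transpose)) ∧
              (MinMax.runRot 𝒜 θ q U V k).outX ∈
                (MinMax.Hx θ q n (2 * k + 1)).map (MinMax.act U.transpose) ∧
              (MinMax.runRot 𝒜 θ q U V k).outY ∈
                (MinMax.Hy θ q n (2 * k + 1)).map (MinMax.act V.transpose) ∧
              q ^ (4 * k + 2) / 16 * ‖xs - 0‖ ^ 2 ≤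
                ‖(MinMax.runRot 𝒜 θ q U V k).outX - MinMax.act U.transpose xs‖ ^ 2) ∧
    (∀ κ : ℝ, 2 < κ → ∃ c : ℝ, 0 < c ∧
      ∀ θ : MinMax.Params, θ.Admissible → κ ≤ θ.cond →
      ∀ q : ℝ, MinMax.IsRate θ q → ∀ C : ℝ, 0 < C →
      ∃ ε₀ : ℝ, 0 < ε₀ ∧ ∀ ε : ℝ, 0 < ε → ε ≤ ε₀ →
      ∃ N : ℕ, ∀ n : ℕ, N ≤ n →
      ∀ 𝒜 : MinMax.PureAlgorithm (MinMax.E n) (MinMax.E n),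
        ∃ U ∈ Matrix.orthogonalGroup (Fin n) ℝ, ∃ V ∈ Matrix.orthogonalGroup (Fin n) ℝ,
          MinMax.InClass θ (MinMax.rotF θ q n U V) ∧
          ∀ k : ℕ,
            MinMax.dualityGap (MinMax.rotF θ q n U V) (MinMax.runRot 𝒜 θ q U V k).outX
                (MinMax.runRot 𝒜 θ q U V k).outY ≤ ((C * ε : ℝ) : EReal) →
              c * √θ.cond * Real.log (1 / ε) ≤ (k : ℝ)) := by
  refine ⟨fun θ hθ => ⟨MinMax.exists_isRate hθ, fun q hq k => ?_⟩, fun κ hκ => ?_⟩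
  · obtain ⟨N, hN⟩ := MinMax.iteration_lower_bound hθ hq k
    refine ⟨N, fun n hn => ?_⟩
    obtain ⟨xs, ys, hs, huniq, h⟩ := hN n hn
    refine ⟨xs, ys, hs, huniq, fun 𝒜 => ?_⟩
    obtain ⟨U, hU, V, hV, hclass, hsad, hit, hout, hdist⟩ := h 𝒜
    exact ⟨U, hU, V, hV, hclass, hsad, hit, hout.1, hout.2, by rwa [sub_zero]⟩
  · obtain ⟨c, hc, hlog⟩ := MinMax.exists_log_rate_bound hκ
    refine ⟨c / 12, by positivity, fun θ hθ hS q hq C hC => ?_⟩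
    have hq0 := hq.pos hθ
    have hμ := hθ.μx_pos
    refine ⟨(θ.μx * q ^ 2 / 128 / C) ^ 2, by positivity, fun ε hε hε₀ => ?_⟩
    obtain ⟨N, hN⟩ := MinMax.gap_lower_bound hθ hq ⌈c / 12 * √θ.cond * Real.log (1 / ε)⌉₊
    refine ⟨N, fun n hn 𝒜 => ?_⟩
    obtain ⟨U, hU, V, hV, hclass, hgap⟩ := hN n hn 𝒜
    refine ⟨U, hU, V, hV, hclass, fun k hk => ?_⟩
    rcases le_total k ⌈c / 12 * √θ.cond * Real.log (1 / ε)⌉₊ with hkK | hkK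
    · have h1 := MinMax.log_le_of_pow_mul_le (by positivity) hC hε hε₀ hq0
        (EReal.coe_le_coe_iff.1 ((hgap k hkK).trans hk))
      calc c / 12 * √θ.cond * Real.log (1 / ε)
          ≤ c / 12 * √θ.cond * (12 * k * Real.log (1 / q)) := by gcongr
        _ = k * (c * √θ.cond * Real.log (1 / q)) := by ring
        _ ≤ k * 1 := mul_le_mul_of_nonneg_left (hlog θ hθ hS q hq) (Nat.cast_nonneg k)
        _ = k := mul_one _
    · exact (Nat.le_ceil _).trans (Nat.cast_le.2 hkK)
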